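/- For each $k\in\mathbb N$ let $\mathbb I_k$ be a finite index set with $n=n_k=|\mathbb I_k|$, $n_k\to\infty$, and let $\mathcal R=\mathcal R_k$ be a collection of subsets of $\mathbb I_k$ (the library of regions). Let $(X_i,Y_i)$, $i\in\mathbb I_k$, be independent, each bivariate normal with mean $(\mu_1,\mu_2)$ and covariance $\mathrm{diag}(\sigma_1^2,\sigma_2^2)$, where $\mu_1,\mu_2\in\mathbb R$ and $\sigma_1,\sigma_2>0$ are arbitrary (they may vary with $k$). For $R\subset\mathbb I_k$ with $|R|\ge 3$ put $$L_R=-(|R|-2)\log(1-r_R^2),\qquad r_R=\frac{\sum_{i\in R}(X_i-\bar X_R)(Y_i-\bar Y_R)}{\sqrt{\sum_{i\in R}(X_i-\bar X_R)^2\sum_{i\in R}(Y_i-\bar Y_R)^2}},$$ where $\bar X_R=|R|^{-1}\sum_{i\in R}X_i$ and $\bar Y_R=|R|^{-1}\sum_{i\in R}Y_i$. Let $A=A_k$ be real numbers with $0<A\le n/4$, put $\mathcal R(A)=\{R\in\mathcal R: A/2<|R|\le A\}$, and assume that $|R|\ge3$ for every $R\in\mathcal R(A)$. (A maximum over an empty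 family is read as $0$.) Let $d(R_1,R_2)=1-|R_1\cap R_2|/\sqrt{|R_1||R_2|}$. For $0<\epsilon<1$ let $N(A,\epsilon)$ be the smallest cardinality of a subfamily $\mathcal S\subset\mathcal R$ such that every $R_1\in\mathcal R(A)$ has some $R_2\in\mathcal S$ with $d(R_1,R_2)\le\epsilon$, and let $N(A,1)$ denote, by convention, the largest number of pairwise disjoint members of $\mathcal R(A)$. Suppose that there are constants $c_1,c_2,c_4,c_5,c_6>0$, not depending on $k$, such that for all $k$ $$|\mathcal R(A)|\le c_1\,n\,A^{c_2}\qquad\text{and}\qquad N(A,\epsilon)\le c_4\,\frac nA\Big(\log\frac nA\Big)^{c_5}\Big(\frac1\epsilon\Big)^{c_6}\quad\text{for all }0<\epsilon<1.$$ Then, as $k\to\infty$, $$\max_{R\in\mathcal R(A)}L_R\le 2\log(n/A)+O_p\big(\log\log(n/A)\big).$$ If in addition there is a constant $c_3>0$, not depending on $k$, such that $N(A,1)\ge c_3\,n/A$ for all $k$, then, as $k\to\infty$, $$\max_{R\in\mathcal R(A)}L_R=2\log(n/A)+O_p\big(\log\log(n/A)\big).$$ Here $Z_k=O_p(a_k)$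 means that for every $\varepsilon>0$ there is $M$ such that $\mathbb P(|Z_k|>M a_k)\le\varepsilon$ for all sufficiently large $k$. -/

import Mathlib

open MeasureTheory ProbabilityTheory Filter

noncomputable section

/-- The sample mean of `x` over the region `R`. -/
def sampleMean {ι : Type*} (R : Finset ι) (x : ι → ℝ) : ℝ :=
  (∑ i ∈ R, x i) / (R.card : ℝ)

/-- The Pearson sample correlation `r_R` of `x` and `y` within the region `R`. -/
def pearsonCorr {ι : Type*} (R : Finset ι) (x y : ι → ℝ) : ℝ :=
  (∑ i ∈ R, (x i - sampleMean R x) * (y i - sampleMean R y)) /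
    Real.sqrt ((∑ i ∈ R, (x i - sampleMean R x) ^ 2) *
      ∑ i ∈ R, (y i - sampleMean R y) ^ 2)

/-- The degree-corrected log-likelihood ratio statistic `L_R = -(|R| - 2) log (1 - r_R ^ 2)`. -/
def logLR {ι : Type*} (R : Finset ι) (x y : ι → ℝ) : ℝ :=
  -((R.card : ℝ) - 2) * Real.log (1 - pearsonCorr R x y ^ 2)

/-- `𝓡(A)`: the regions of the library `𝓡` whose size lies in `(A / 2, A]`. -/
def regionsOfSize {ι : Type*} (𝓡 : Finset (Finset ι)) (A : ℝ) : Finset (Finset ι) :=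
  𝓡.filter fun R => (R.card : ℝ) ∈ Set.Ioc (A / 2) A

/-- `max_{R ∈ 𝓡(A)} L_R`; a maximum over a finite family (`0` if the family is empty). -/
def maxLogLR {ι : Type*} (𝓡 : Finset (Finset ι)) (A : ℝ) (x y : ι → ℝ) : ℝ :=
  ⨆ R : {R // R ∈ regionsOfSize 𝓡 A}, logLR R.1 x y

/-- The dissimilarity `d(R₁, R₂) = 1 - |R₁ ∩ R₂| / √(|R₁| |R₂|)`. -/
def regionDist {ι : Type*} [DecidableEq ι] (R₁ R₂ : Finset ι) : ℝ :=
  1 - ((R₁ ∩ R₂).card : ℝ) / Real.sqrt ((R₁.card : ℝ) * (R₂.card : ℝ))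

/-- The covering number `N(A, ε)`: the smallest size of a subfamily of the whole library `𝓡`
that has, for every region of `𝓡(A)`, a member within distance `ε` of it. -/
def coveringNumber {ι : Type*} [DecidableEq ι] (𝓡 : Finset (Finset ι)) (A ε : ℝ) : ℕ :=
  sInf {m : ℕ | ∃ S : Finset (Finset ι), S ⊆ 𝓡 ∧ S.card = m ∧
    ∀ R₁ ∈ regionsOfSize 𝓡 A, ∃ R₂ ∈ S, regionDist R₁ R₂ ≤ ε}

open Classical in
/-- The packing number, written `N(A, 1)` by convention: the largest number of pairwise
non-overlapping regions of `𝓡(A)`. -/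
def packingNumber {ι : Type*} (𝓡 : Finset (Finset ι)) (A : ℝ) : ℕ :=
  ((regionsOfSize 𝓡 A).powerset.filter
    fun S : Finset (Finset ι) => (S : Set (Finset ι)).PairwiseDisjoint id).sup Finset.card

/-- The null model on the index set `ι`: the pairs `(X i, Y i)` are independent over `i`, and each
of them is bivariate normal with mean `(μ₁, μ₂)` and covariance `diag (σ₁ ^ 2, σ₂ ^ 2)`. -/
structure IsNullModel {ι Ω : Type*} [MeasurableSpace Ω] (P : Measure Ω) (X Y : ι → Ω → ℝ)
    (μ₁ μ₂ σ₁ σ₂ : ℝ) : Prop where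
  indep : iIndepFun (fun i ω => (X i ω, Y i ω)) P
  law : ∀ i, HasLaw (fun ω => (X i ω, Y i ω))
    ((gaussianReal μ₁ (Real.toNNReal (σ₁ ^ 2))).prod
      (gaussianReal μ₂ (Real.toNNReal (σ₂ ^ 2)))) P

/-- `Z_k = O_p(a_k)` as `k → ∞`, where `Z_k` is a real function on the probability space
`(Ω k, P k)`. -/
def IsBigOInProb {Ω : ℕ → Type*} [∀ k, MeasurableSpace (Ω k)] (P : ∀ k, Measure (Ω k))
    (Z : ∀ k, Ω k → ℝ) (a : ℕ → ℝ) : Prop :=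
  ∀ ε : ℝ, 0 < ε → ∃ M : ℝ, ∀ᶠ k in atTop,
    P k {ω | M * a k < |Z k ω|} ≤ ENNReal.ofReal ε

end

/-!
The statistic `L_R` of a single region has tails `e^{-t/2}` up to a power of `t`, uniformly in the
size of the region: given the `X i`, a rotation turns `1 - r_R ^ 2` into `Q / (Z ^ 2 + Q)`, with `Z`
standard normal and `Q` an independent chi-square variable with `|R| - 2` degrees of freedom, so
that `P(L_R > t) = E P(|Z| > √(k Q) | Q)` with `k = e^{t / (|R| - 2)} - 1`. Bounding the Gaussian
tail by a Gaussian weight and taking the Laplace transform of `Q` gives `2 e^{-t/2}` from above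
(`nullPi_lt_logLR_le`), and `c √η e^{-(1 + η) t / 2}` for all `0 < η ≤ 1` from below
(`le_nullPi_lt_logLR`). Write `ρ = n / A` and `ℓ = log ρ`.

*Lower bound.* Disjoint regions have independent statistics, and there are at least `c₃ ρ` of them.
At the threshold `2 ℓ - M log ℓ`, with `η = 1 / (2 ℓ)`, the expected number of exceedances is at
least a power of `ℓ` that grows with `M` (`exists_nullPi_forall_logLR_le_le`).

*Upper bound, small regions.* If `A ≤ ℓ ^ 16`, then `𝓡(A)` has at most `ρ` members up to a power of
`ℓ`, and the union bound suffices (`exists_nullPi_lt_logLR_le_of_le_log`).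

*Upper bound, large regions.* If `A = a ^ 16` with `a ≥ ℓ`, then `log n = ℓ + log A` is at most of
the order of `a`, a small power of `A`. The sample means and variances of all regions are therefore
close to their expectations at once, and `L_R` is at most `W_R ^ 2 + 3`, where `W_R = |R|^{-1/2} ∑ i ∈ R, X i Y i`
(`logLR_le_of_moments`). The process `W` has sub-Gaussian increments in the range of interest, with
variance proxy given by the dissimilarity of the regions. A net at scale `ℓ⁻²` has `ρ` members up to
a power of `ℓ`, and on it `W_R ^ 2 ≤ 2 ℓ + M log ℓ`. Chaining through nets at the scales `ℓ⁻² 16⁻ʲ`,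
down to about `a⁻⁴`, adds `O(ℓ^{-1/2})` (`exists_net_nullPi_lt_abs_crossSum_le`), and from there
the union bound over all of `𝓡(A)` takes over (`exists_nullPi_lt_logLR_le_of_log_le`). All bounds
are proved for standard normal pairs on the canonical product space; the sample correlation is
invariant under affine changes of scale, so they transfer to every null model.
-/

/-! ### One-dimensional Gaussian integrals and tails -/

/-- The standard normal distribution on `ℝ`. -/
noncomputable abbrev stdNormal : Measure ℝ := gaussianReal 0 1

lemma lintegral_exp_neg_sq_stdNormal {s : ℝ} (hs : -(1 / 2) < s) :
    ∫⁻ z, ENNReal.ofReal (Real.exp (-s * z ^ 2)) ∂stdNormal =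
      ENNReal.ofReal ((Real.sqrt (1 + 2 * s))⁻¹) := by
  have hb : 0 < s + 1 / 2 := by linarith
  rw [stdNormal, gaussianReal_of_var_ne_zero _ one_ne_zero,
    lintegral_withDensity_eq_lintegral_mul _ (measurable_gaussianPDF 0 1) (by fun_prop)]
  have h1 : ∀ z : ℝ, (gaussianPDF 0 1 * fun z => ENNReal.ofReal (Real.exp (-s * z ^ 2))) z =
      ENNReal.ofReal ((Real.sqrt (2 * Real.pi))⁻¹ * Real.exp (-(s + 1 / 2) * z ^ 2)) := by
    intro z
    simp only [Pi.mul_apply, gaussianPDF, gaussianPDFReal, NNReal.coe_one, mul_one, sub_zero]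
    rw [← ENNReal.ofReal_mul (by positivity), mul_assoc, ← Real.exp_add]
    congr 3
    ring
  simp_rw [h1]
  rw [← ofReal_integral_eq_lintegral_ofReal ((integrable_exp_neg_mul_sq hb).const_mul _)
    (Eventually.of_forall fun z => by positivity), integral_const_mul, integral_gaussian]
  congr 1
  rw [← Real.sqrt_inv, ← Real.sqrt_mul (by positivity), ← Real.sqrt_inv]
  congr 1
  have := Real.pi_pos
  field_simp
  ring

lemma lintegral_exp_mul_stdNormal (s : ℝ) :
    ∫⁻ z, ENNReal.ofReal (Real.exp (s * z)) ∂stdNormal = ENNReal.ofReal (Real.exp (s ^ 2 / 2)) := by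
  rw [← ofReal_integral_eq_lintegral_ofReal (integrable_exp_mul_gaussianReal s)
    (Eventually.of_forall fun z => by positivity)]
  have := congrFun (mgf_id_gaussianReal (μ := 0) (v := 1)) s
  simp only [mgf, id, NNReal.coe_one, zero_mul, one_mul, zero_add] at this
  rw [this]

/-- The moment generating function of the product of two independent standard normal variables. -/
lemma lintegral_exp_mul_mul_stdNormal {s : ℝ} (hs : s ^ 2 < 1) :
    ∫⁻ p, ENNReal.ofReal (Real.exp (s * (p.1 * p.2))) ∂(stdNormal.prod stdNormal) =
      ENNReal.ofReal ((Real.sqrt (1 - s ^ 2))⁻¹) := by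
  rw [lintegral_prod _ (by fun_prop)]
  have h1 : ∀ x : ℝ, ∫⁻ y, ENNReal.ofReal (Real.exp (s * (x * y))) ∂stdNormal =
      ENNReal.ofReal (Real.exp (-(-(s ^ 2 / 2)) * x ^ 2)) := by
    intro x
    have := lintegral_exp_mul_stdNormal (s * x)
    simp only [mul_assoc] at this ⊢
    rw [this]
    congr 2
    ring
  simp_rw [h1]
  rw [lintegral_exp_neg_sq_stdNormal (by linarith)]
  congr 4
  ring

/-- The exponential Markov inequality, with the value of the moment supplied. -/
lemma measure_le_of_lintegral_exp {α : Type*} [MeasurableSpace α] {μ : Measure α} {f : α → ℝ}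
    (hf : Measurable f) {κ : ℝ}
    (h : ∫⁻ x, ENNReal.ofReal (Real.exp (f x)) ∂μ ≤ ENNReal.ofReal (Real.exp κ)) (t : ℝ) :
    μ {x | t ≤ f x} ≤ ENNReal.ofReal (Real.exp (κ - t)) := by
  have h1 : {x | t ≤ f x} ⊆
      {x | ENNReal.ofReal (Real.exp t) ≤ ENNReal.ofReal (Real.exp (f x))} := by
    intro x hx
    exact ENNReal.ofReal_le_ofReal (Real.exp_le_exp.2 hx)
  have hpos : ENNReal.ofReal (Real.exp t) ≠ 0 := by
    simp [Real.exp_pos]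
  calc μ {x | t ≤ f x}
      ≤ (∫⁻ x, ENNReal.ofReal (Real.exp (f x)) ∂μ) / ENNReal.ofReal (Real.exp t) :=
        (measure_mono h1).trans
          (meas_ge_le_lintegral_div (by fun_prop) hpos ENNReal.ofReal_ne_top)
    _ ≤ ENNReal.ofReal (Real.exp κ) / ENNReal.ofReal (Real.exp t) := by gcongr
    _ = ENNReal.ofReal (Real.exp (κ - t)) := by
        rw [← ENNReal.ofReal_div_of_pos (Real.exp_pos t), ← Real.exp_sub]

lemma stdNormal_abs_gt_le (t : ℝ) (ht : 0 ≤ t) :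
    stdNormal {z | t < |z|} ≤ ENNReal.ofReal (2 * Real.exp (-t ^ 2 / 2)) := by
  have key : ∀ e : ℝ, e ^ 2 = 1 → stdNormal {z | t * t ≤ t * e * z} ≤
      ENNReal.ofReal (Real.exp (-t ^ 2 / 2)) := by
    intro e he
    have := measure_le_of_lintegral_exp (μ := stdNormal) (f := fun z => t * e * z) (by fun_prop)
      (lintegral_exp_mul_stdNormal (t * e)).le (t * t)
    refine this.trans (le_of_eq ?_)
    congr 2
    rw [mul_pow, he]
    ring
  have hsub : {z : ℝ | t < |z|} ⊆ {z | t * t ≤ t * 1 * z} ∪ {z | t * t ≤ t * (-1) * z} := by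
    intro z hz
    rcases lt_abs.1 (show t < |z| from hz) with h | h
    · left
      have := mul_le_mul_of_nonneg_left h.le ht
      simpa using this
    · right
      have := mul_le_mul_of_nonneg_left h.le ht
      simpa using this
  calc stdNormal {z | t < |z|} ≤ _ := measure_mono hsub
    _ ≤ _ := measure_union_le _ _
    _ ≤ _ := add_le_add (key 1 (by norm_num)) (key (-1) (by norm_num))
    _ = _ := by rw [← ENNReal.ofReal_add (by positivity) (by positivity), two_mul]

/-- The constant `e⁻¹ / √(2π)` of the Gaussian lower tail bound. -/
noncomputable def gaussTailConst : ℝ := (Real.sqrt (2 * Real.pi))⁻¹ * Real.exp (-1)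

lemma gaussTailConst_pos : 0 < gaussTailConst := by
  unfold gaussTailConst
  have := Real.pi_pos
  positivity

/-- A lower bound for the Gaussian tail that is itself a Gaussian weight. Compared with the usual
`e^{-t²/2} / (1 + t)`, it integrates exactly against a chi-square variable in place of `t²`. -/
lemma le_stdNormal_abs_gt {t η : ℝ} (ht : 0 ≤ t) (hη : 0 < η) (hη1 : η ≤ 1) :
    ENNReal.ofReal (gaussTailConst * Real.sqrt η * Real.exp (-(1 + η) * t ^ 2 / 2)) ≤
      stdNormal {z | t < |z|} := by
  set h := Real.sqrt η with hh
  have hsq : h ^ 2 = η := Real.sq_sqrt hη.le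
  have hpos : 0 < h := Real.sqrt_pos.2 hη
  have hsub : Set.Ioc t (t + h) ⊆ {z : ℝ | t < |z|} := fun z hz =>
    lt_of_lt_of_le hz.1 (le_abs_self z)
  refine le_trans ?_ (measure_mono hsub)
  rw [stdNormal, gaussianReal_apply _ one_ne_zero]
  -- on the interval `(t, t + √η]` the density is at least its value at the right end
  have hbound : ∀ z ∈ Set.Ioc t (t + h),
      ENNReal.ofReal (gaussTailConst * Real.exp (-(1 + η) * t ^ 2 / 2)) ≤ gaussianPDF 0 1 z := by
    intro z hz
    unfold gaussianPDF gaussianPDFReal gaussTailConst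
    refine ENNReal.ofReal_le_ofReal ?_
    simp only [NNReal.coe_one, mul_one, sub_zero]
    rw [mul_assoc, ← Real.exp_add]
    refine mul_le_mul_of_nonneg_left (Real.exp_le_exp.2 ?_) (by positivity)
    have h1 : z ^ 2 ≤ (t + h) ^ 2 := by
      have := hz.1
      have := hz.2
      nlinarith
    -- `(t + h)² ≤ (1 + η) t² + (1 + 1/η) h²`
    have h2 : 2 * t * h ≤ η * t ^ 2 + 1 := by nlinarith [sq_nonneg (h * t - 1)]
    nlinarith
  calc ENNReal.ofReal (gaussTailConst * h * Real.exp (-(1 + η) * t ^ 2 / 2))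
      = ∫⁻ _ in Set.Ioc t (t + h),
          ENNReal.ofReal (gaussTailConst * Real.exp (-(1 + η) * t ^ 2 / 2)) := by
        rw [setLIntegral_const, Real.volume_Ioc, ← ENNReal.ofReal_mul
          (mul_nonneg gaussTailConst_pos.le (Real.exp_pos _).le)]
        congr 1
        ring
    _ ≤ _ := setLIntegral_mono (measurable_gaussianPDF 0 1) hbound

/-- The union bound. -/
lemma measure_exists_mem_le {Ω β : Type*} [MeasurableSpace Ω] {μ : Measure Ω} {T : Finset β}
    {E : β → Ω → Prop} {p : ℝ} (h : ∀ R ∈ T, μ {ω | E R ω} ≤ ENNReal.ofReal p) :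
    μ {ω | ∃ R ∈ T, E R ω} ≤ ENNReal.ofReal (T.card * p) := by
  have hsub : {ω | ∃ R ∈ T, E R ω} ⊆ ⋃ R ∈ T, {ω | E R ω} := by
    rintro ω ⟨R, hR, hω⟩
    simp only [Set.mem_iUnion]
    exact ⟨R, hR, hω⟩
  refine (measure_mono hsub).trans ((measure_biUnion_finset_le _ _).trans
    ((Finset.sum_le_sum h).trans (le_of_eq ?_)))
  rw [Finset.sum_const, nsmul_eq_mul, ENNReal.ofReal_mul (by positivity), ENNReal.ofReal_natCast]

/-! ### Product measures -/

lemma lintegral_pi_prod {ι : Type*} [Fintype ι] {α : Type*} [MeasurableSpace α] {μ : Measure α}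
    [IsProbabilityMeasure μ] {f : ι → α → ENNReal} (hf : ∀ i, Measurable (f i)) :
    ∫⁻ x, ∏ i, f i (x i) ∂(Measure.pi fun _ : ι => μ) = ∏ i, ∫⁻ a, f i a ∂μ := by
  have h := lintegral_prod_eq_prod_lintegral_of_indepFun (μ := Measure.pi fun _ : ι => μ)
    Finset.univ (fun i x => f i (x i)) (iIndepFun_pi fun i => (hf i).aemeasurable)
    (fun i => (hf i).comp (measurable_pi_apply i))
  rw [h]
  refine Finset.prod_congr rfl fun i _ => ?_
  exact (measurePreserving_eval (fun _ : ι => μ) i).lintegral_comp (hf i)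

/-- Chernoff's bound for a sum of independent terms, the moment generating functions of which are
bounded one by one. -/
lemma chernoff_pi {ι : Type*} [Fintype ι] {α : Type*} [MeasurableSpace α] {μ : Measure α}
    [IsProbabilityMeasure μ] {ψ : ι → α → ℝ} (hψ : ∀ i, Measurable (ψ i)) {κ : ι → ℝ}
    (h : ∀ i, ∫⁻ a, ENNReal.ofReal (Real.exp (ψ i a)) ∂μ ≤ ENNReal.ofReal (Real.exp (κ i)))
    (t : ℝ) :
    (Measure.pi fun _ : ι => μ) {x | t ≤ ∑ i, ψ i (x i)} ≤
      ENNReal.ofReal (Real.exp (∑ i, κ i - t)) := by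
  refine measure_le_of_lintegral_exp (by fun_prop) ?_ t
  simp_rw [Real.exp_sum]
  rw [ENNReal.ofReal_prod_of_nonneg (fun i _ => (Real.exp_pos _).le)]
  simp_rw [ENNReal.ofReal_prod_of_nonneg (fun i _ => (Real.exp_pos _).le)]
  rw [lintegral_pi_prod (f := fun i a => ENNReal.ofReal (Real.exp (ψ i a)))
    (fun i => by have := hψ i; fun_prop)]
  exact Finset.prod_le_prod' fun i _ => h i

/-! ### The null distribution of the sample correlation -/

lemma sum_centered_mul {ι : Type*} {R : Finset ι} (hR : R.Nonempty) (x y : ι → ℝ) :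
    ∑ i ∈ R, (x i - sampleMean R x) * (y i - sampleMean R y) =
      ∑ i ∈ R, x i * y i - (∑ i ∈ R, x i) * (∑ i ∈ R, y i) / R.card := by
  have hc : (R.card : ℝ) ≠ 0 := by exact_mod_cast hR.card_pos.ne'
  have : ∀ i, (x i - sampleMean R x) * (y i - sampleMean R y) =
      x i * y i - x i * sampleMean R y - sampleMean R x * y i
        + sampleMean R x * sampleMean R y := fun i => by ring
  simp_rw [this, Finset.sum_add_distrib, Finset.sum_sub_distrib, ← Finset.sum_mul,
    ← Finset.mul_sum, Finset.sum_const, nsmul_eq_mul, sampleMean]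
  field_simp
  ring

lemma sum_centered_sq {ι : Type*} {R : Finset ι} (hR : R.Nonempty) (x : ι → ℝ) :
    ∑ i ∈ R, (x i - sampleMean R x) ^ 2 =
      ∑ i ∈ R, x i ^ 2 - (∑ i ∈ R, x i) ^ 2 / R.card := by
  have := sum_centered_mul hR x x
  simpa only [← sq] using this

lemma pearsonCorr_sq_le_one {ι : Type*} (R : Finset ι) (x y : ι → ℝ) :
    pearsonCorr R x y ^ 2 ≤ 1 := by
  unfold pearsonCorr
  rw [div_pow, Real.sq_sqrt (mul_nonneg (Finset.sum_nonneg fun _ _ => sq_nonneg _)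
    (Finset.sum_nonneg fun _ _ => sq_nonneg _))]
  refine div_le_one_of_le₀ (Finset.sum_mul_sq_le_sq_mul_sq R _ _) ?_
  exact mul_nonneg (Finset.sum_nonneg fun _ _ => sq_nonneg _)
    (Finset.sum_nonneg fun _ _ => sq_nonneg _)

lemma logLR_nonneg {ι : Type*} {R : Finset ι} (hR : 2 ≤ R.card) (x y : ι → ℝ) :
    0 ≤ logLR R x y := by
  have h1 := pearsonCorr_sq_le_one R x y
  have h2 : Real.log (1 - pearsonCorr R x y ^ 2) ≤ 0 :=
    Real.log_nonpos (by linarith) (by linarith [sq_nonneg (pearsonCorr R x y)])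
  have h3 : (2 : ℝ) ≤ R.card := by exact_mod_cast hR
  unfold logLR
  nlinarith

lemma logLR_eq_univ {ι : Type*} (R : Finset ι) (x y : ι → ℝ) :
    logLR R x y = logLR (Finset.univ : Finset R) (fun i => x i) fun i => y i := by
  have h : ∀ f : ι → ℝ, ∑ i : R, f i = ∑ i ∈ R, f i := fun f => Finset.sum_coe_sort R f
  have hm : ∀ f : ι → ℝ, sampleMean (Finset.univ : Finset R) (fun i => f i) = sampleMean R f := by
    intro f
    unfold sampleMean
    rw [h, Finset.card_univ, Fintype.card_coe]
  unfold logLR pearsonCorr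
  rw [hm, hm, h fun i => (x i - sampleMean R x) * (y i - sampleMean R y),
    h fun i => (x i - sampleMean R x) ^ 2, h fun i => (y i - sampleMean R y) ^ 2,
    Finset.card_univ, Fintype.card_coe]

/-- For fixed nonconstant `x`, a standard Gaussian vector `y` has Gaussian coordinates `g` in an
orthonormal basis that starts with the direction of the centered `x` and the constant direction.
In them the sample covariance is a multiple of `g 0`, and the sample variance of `y` is the sum of
the squares of all coordinates but `g 1`. -/
lemma exists_gaussian_coordinates {κ : Type*} [Fintype κ] {d : ℕ} (hd : Fintype.card κ = d + 2)
    (x : κ → ℝ) (hx : 0 < ∑ i, (x i - sampleMean Finset.univ x) ^ 2) :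
    ∃ T : (Fin (d + 2) → ℝ) → κ → ℝ,
      MeasurePreserving T (Measure.pi fun _ => stdNormal) (Measure.pi fun _ => stdNormal) ∧
      ∀ g, ∑ i, (x i - sampleMean Finset.univ x) * (T g i - sampleMean Finset.univ (T g)) =
          Real.sqrt (∑ i, (x i - sampleMean Finset.univ x) ^ 2) * g 0 ∧
        ∑ i, (T g i - sampleMean Finset.univ (T g)) ^ 2 =
          g 0 ^ 2 + ∑ j : Fin d, g j.succ.succ ^ 2 := by
  classical
  have hne : (Finset.univ : Finset κ).Nonempty := by
    rw [← Finset.card_pos, Finset.card_univ, hd]; omega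
  set cx : κ → ℝ := fun i => x i - sampleMean Finset.univ x with hcx
  set s := ∑ i, cx i ^ 2 with hs
  have hs0 : Real.sqrt s ≠ 0 := (Real.sqrt_pos.2 hx).ne'
  have hm0 : (0 : ℝ) < Fintype.card κ := by rw [hd]; positivity
  set m : ℝ := (Fintype.card κ : ℝ) with hm
  have hm0' : Real.sqrt m ≠ 0 := (Real.sqrt_pos.2 hm0).ne'
  have hcx0 : ∑ i, cx i = 0 := by
    simp only [hcx, Finset.sum_sub_distrib, sampleMean, Finset.sum_const, nsmul_eq_mul,
      Finset.card_univ]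
    rw [← hm, mul_div_cancel₀ _ hm0.ne', sub_self]
  let u : EuclideanSpace ℝ κ := WithLp.toLp 2 fun i => cx i / Real.sqrt s
  let o : EuclideanSpace ℝ κ := WithLp.toLp 2 fun _ => 1 / Real.sqrt m
  have huu : inner ℝ u u = (1 : ℝ) := by
    simp only [u, PiLp.inner_apply, RCLike.inner_apply, conj_trivial]
    have : ∀ i, cx i / Real.sqrt s * (cx i / Real.sqrt s) = cx i ^ 2 / s := fun i => by
      rw [div_mul_div_comm, Real.mul_self_sqrt hx.le, sq]
    simp_rw [this, ← Finset.sum_div]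
    exact div_self hx.ne'
  have hoo : inner ℝ o o = (1 : ℝ) := by
    simp only [o, PiLp.inner_apply, RCLike.inner_apply, conj_trivial]
    simp only [div_mul_div_comm, Real.mul_self_sqrt hm0.le, Finset.sum_const, nsmul_eq_mul,
      Finset.card_univ, ← hm]
    field_simp
  have huo : inner ℝ u o = (0 : ℝ) := by
    simp only [u, o, PiLp.inner_apply, RCLike.inner_apply, conj_trivial]
    rw [← Finset.mul_sum, ← Finset.sum_div, hcx0]
    simp
  let v : Fin (d + 2) → EuclideanSpace ℝ κ := fun j => if j = 0 then u else o
  have hv : Orthonormal ℝ (({0, 1} : Set (Fin (d + 2))).domRestrict v) := by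
    rw [orthonormal_iff_ite]
    rintro ⟨i, hi⟩ ⟨j, hj⟩
    rcases hi with rfl | hi <;> rcases hj with rfl | hj
    · simpa [v] using huu
    · rw [Set.mem_singleton_iff] at hj; subst hj
      rw [if_neg fun h => absurd (congrArg Subtype.val h) (by simp)]
      simpa [v] using huo
    · rw [Set.mem_singleton_iff] at hi; subst hi
      rw [real_inner_comm, if_neg fun h => absurd (congrArg Subtype.val h) (by simp)]
      simpa [v] using huo
    · rw [Set.mem_singleton_iff] at hi hj; subst hi; subst hj
      simpa [v] using hoo
  obtain ⟨b, hb⟩ := hv.exists_orthonormalBasis_extension_of_card_eq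
    (by rw [finrank_euclideanSpace, hd, Fintype.card_fin])
  have hb0 : b 0 = u := by rw [hb 0 (by simp)]; simp [v]
  have hb1 : b 1 = o := by rw [hb 1 (by simp)]; simp [v]
  let T : (Fin (d + 2) → ℝ) → κ → ℝ := fun g => WithLp.ofLp (∑ j, g j • b j)
  refine ⟨T, ⟨by fun_prop, ?_⟩, fun g => ?_⟩
  · have h1 : T = WithLp.ofLp ∘ (fun g : Fin (d + 2) → ℝ => ∑ j, g j • b j) := rfl
    rw [h1, ← Measure.map_map (by fun_prop) (by fun_prop),
      ← stdGaussian_eq_map_pi_orthonormalBasis b, ← map_pi_eq_stdGaussian,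
      Measure.map_map (by fun_prop) (by fun_prop)]
    exact Measure.map_id
  · set y : EuclideanSpace ℝ κ := ∑ j, g j • b j with hy
    have hTy : ∀ i, T g i = y i := fun i => rfl
    have hg : ∀ j, inner ℝ (b j) y = g j := fun j => by
      rw [hy, b.orthonormal.inner_right_fintype]
    have hg0 : ∑ i, cx i * y i = Real.sqrt s * g 0 := by
      rw [← hg 0, hb0]
      simp only [u, PiLp.inner_apply, RCLike.inner_apply, conj_trivial, Finset.mul_sum]
      refine Finset.sum_congr rfl fun i _ => ?_
      field_simp
    have hg1 : (∑ i, y i) ^ 2 / m = g 1 ^ 2 := by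
      rw [← hg 1, hb1]
      simp only [o, PiLp.inner_apply, RCLike.inner_apply, conj_trivial]
      rw [← Finset.sum_mul, mul_pow, div_pow, Real.sq_sqrt hm0.le]
      ring
    have hnorm : ∑ i, y i ^ 2 = ∑ j, g j ^ 2 := by
      have h1 := b.sum_sq_norm_inner_right y
      simp_rw [hg] at h1
      rw [EuclideanSpace.real_norm_sq_eq] at h1
      simpa using h1.symm
    constructor
    · have h1 : ∀ i, cx i * (T g i - sampleMean Finset.univ (T g)) =
          cx i * y i - cx i * sampleMean Finset.univ (T g) := fun i => by rw [hTy]; ring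
      refine (Finset.sum_congr rfl fun i _ => h1 i).trans ?_
      rw [Finset.sum_sub_distrib, ← Finset.sum_mul, hcx0, hg0]
      ring
    · rw [sum_centered_sq hne]
      simp_rw [hTy]
      rw [hnorm, Finset.card_univ, ← hm, hg1, Fin.sum_univ_succ, Fin.sum_univ_succ,
        Fin.succ_zero_eq_one]
      ring

/-- In the rotated coordinates a large value of the statistic forces `g 0 ^ 2` to exceed a multiple
of the residual sum of squares `Q`. -/
lemma lt_abs_of_lt_logLR {c s z Q D t : ℝ} (hs : 0 < s) (hQ : 0 ≤ Q) (hD : 0 < D) (ht : 0 ≤ t)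
    (hc : c = Real.sqrt s * z / Real.sqrt (s * (z ^ 2 + Q)))
    (h : t < -D * Real.log (1 - c ^ 2)) :
    Real.sqrt ((Real.exp (t / D) - 1) * Q) < |z| := by
  have hT0 : 0 ≤ z ^ 2 + Q := by positivity
  have hc2 : c ^ 2 = z ^ 2 / (z ^ 2 + Q) := by
    rw [hc, div_pow, mul_pow, Real.sq_sqrt hs.le, Real.sq_sqrt (by positivity),
      mul_div_mul_left _ _ hs.ne']
  have hT : 0 < z ^ 2 + Q := by
    rcases hT0.eq_or_lt with h0 | h0
    · rw [hc2, ← h0] at h; simp at h; linarith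
    · exact h0
  have h1c : 1 - c ^ 2 = Q / (z ^ 2 + Q) := by
    rw [hc2]; field_simp; ring
  have hQpos : 0 < Q := by
    rcases hQ.eq_or_lt with h0 | h0
    · rw [h1c, ← h0] at h; simp at h; linarith
    · exact h0
  have hlog : Real.log (1 - c ^ 2) < -(t / D) := by
    rw [lt_neg, div_lt_iff₀ hD]; linarith
  rw [h1c, Real.log_lt_iff_lt_exp (by positivity), Real.exp_neg, div_lt_iff₀ hT] at hlog
  have hE := Real.exp_pos (t / D)
  rw [← Real.sqrt_sq_eq_abs]
  have hk : 0 ≤ Real.exp (t / D) - 1 := by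
    linarith [Real.one_le_exp (show 0 ≤ t / D by positivity)]
  refine Real.sqrt_lt_sqrt (mul_nonneg hk hQ) ?_
  have := mul_lt_mul_of_pos_left hlog hE
  rw [← mul_assoc, mul_inv_cancel₀ hE.ne'] at this
  linarith

lemma lt_logLR_of_lt_abs {c s z Q D t : ℝ} (hs : 0 < s) (hQ : 0 < Q) (hD : 0 < D)
    (ht : 0 ≤ t) (hc : c = Real.sqrt s * z / Real.sqrt (s * (z ^ 2 + Q)))
    (h : Real.sqrt ((Real.exp (t / D) - 1) * Q) < |z|) :
    t < -D * Real.log (1 - c ^ 2) := by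
  have hT : 0 < z ^ 2 + Q := by positivity
  have hc2 : c ^ 2 = z ^ 2 / (z ^ 2 + Q) := by
    rw [hc, div_pow, mul_pow, Real.sq_sqrt hs.le, Real.sq_sqrt (by positivity),
      mul_div_mul_left _ _ hs.ne']
  have h1c : 1 - c ^ 2 = Q / (z ^ 2 + Q) := by
    rw [hc2]; field_simp; ring
  have hE := Real.exp_pos (t / D)
  rw [← Real.sqrt_sq_eq_abs] at h
  have h2 := (Real.sqrt_lt_sqrt_iff (mul_nonneg
    (by linarith [Real.one_le_exp (show 0 ≤ t / D by positivity)]) hQ.le)).1 h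
  have hlog : Real.log (1 - c ^ 2) < -(t / D) := by
    rw [h1c, Real.log_lt_iff_lt_exp (by positivity), Real.exp_neg, div_lt_iff₀ hT,
      lt_inv_mul_iff₀ hE]
    linarith
  rw [lt_neg, div_lt_iff₀ hD] at hlog
  linarith

lemma lintegral_exp_neg_sum_sq_pi (d : ℕ) {k : ℝ} (hk : 0 ≤ k) :
    ∫⁻ w, ENNReal.ofReal (Real.exp (-(k * ∑ j : Fin d, w j.succ ^ 2) / 2))
      ∂(Measure.pi fun _ : Fin (d + 1) => stdNormal) =
      ENNReal.ofReal ((Real.sqrt (1 + k))⁻¹ ^ d) := by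
  let f : Fin (d + 1) → ℝ → ENNReal :=
    Fin.cons (fun _ => 1) fun _ z => ENNReal.ofReal (Real.exp (-(k / 2) * z ^ 2))
  have h1 : ∀ w : Fin (d + 1) → ℝ,
      ENNReal.ofReal (Real.exp (-(k * ∑ j : Fin d, w j.succ ^ 2) / 2)) = ∏ i, f i (w i) := by
    intro w
    rw [Fin.prod_univ_succ]
    simp only [f, Fin.cons_zero, Fin.cons_succ, one_mul]
    rw [← ENNReal.ofReal_prod_of_nonneg (fun _ _ => (Real.exp_pos _).le), ← Real.exp_sum,
      ← Finset.mul_sum]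
    congr 2
    ring
  simp_rw [h1]
  rw [lintegral_pi_prod, Fin.prod_univ_succ]
  · simp only [f, Fin.cons_zero, Fin.cons_succ]
    rw [lintegral_exp_neg_sq_stdNormal (by linarith)]
    simp only [lintegral_const, measure_univ, mul_one, Finset.prod_const, Finset.card_univ,
      Fintype.card_fin, one_mul]
    rw [← ENNReal.ofReal_pow (by positivity)]
    congr 5
    ring
  · intro i
    refine Fin.cases ?_ (fun j => ?_) i
    · simp only [f, Fin.cons_zero]; fun_prop
    · simp only [f, Fin.cons_succ]; fun_prop

/-- The event that the first Gaussian coordinate dominates the residual sum of squares, integrated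
over the first coordinate. -/
lemma pi_sqrt_lt_abs_eq_lintegral (d : ℕ) (k : ℝ) :
    (Measure.pi fun _ : Fin (d + 2) => stdNormal)
      {g | Real.sqrt (k * ∑ j : Fin d, g j.succ.succ ^ 2) < |g 0|} =
    ∫⁻ w, stdNormal {z | Real.sqrt (k * ∑ j : Fin d, w j.succ ^ 2) < |z|}
      ∂(Measure.pi fun _ : Fin (d + 1) => stdNormal) := by
  have hmp := measurePreserving_piFinSuccAbove (fun _ : Fin (d + 2) => stdNormal) 0
  have hms : MeasurableSet {p : ℝ × (Fin (d + 1) → ℝ) |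
      Real.sqrt (k * ∑ j : Fin d, p.2 j.succ ^ 2) < |p.1|} :=
    measurableSet_lt (by fun_prop) (by fun_prop)
  have h1 := hmp.measure_preimage hms.nullMeasurableSet
  rw [Measure.prod_apply_symm hms] at h1
  exact h1

lemma pi_sqrt_lt_abs_le (d : ℕ) {k : ℝ} (hk : 0 ≤ k) :
    (Measure.pi fun _ : Fin (d + 2) => stdNormal)
      {g | Real.sqrt (k * ∑ j : Fin d, g j.succ.succ ^ 2) < |g 0|} ≤
    ENNReal.ofReal (2 * (Real.sqrt (1 + k))⁻¹ ^ d) := by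
  rw [pi_sqrt_lt_abs_eq_lintegral, ENNReal.ofReal_mul (by norm_num),
    ← lintegral_exp_neg_sum_sq_pi d hk, ← lintegral_const_mul _ (by fun_prop)]
  refine lintegral_mono fun w => ?_
  refine (stdNormal_abs_gt_le _ (Real.sqrt_nonneg _)).trans (le_of_eq ?_)
  rw [ENNReal.ofReal_mul (by norm_num), neg_div, neg_div, Real.sq_sqrt
    (mul_nonneg hk (Finset.sum_nonneg fun _ _ => sq_nonneg _))]

lemma le_pi_sqrt_lt_abs (d : ℕ) {k η : ℝ} (hk : 0 ≤ k) (hη : 0 < η) (hη1 : η ≤ 1) :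
    ENNReal.ofReal (gaussTailConst * Real.sqrt η * (Real.sqrt (1 + (1 + η) * k))⁻¹ ^ d) ≤
    (Measure.pi fun _ : Fin (d + 2) => stdNormal)
      {g | Real.sqrt (k * ∑ j : Fin d, g j.succ.succ ^ 2) < |g 0|} := by
  have hc := gaussTailConst_pos
  rw [pi_sqrt_lt_abs_eq_lintegral, ENNReal.ofReal_mul (by positivity),
    ← lintegral_exp_neg_sum_sq_pi d (by positivity), ← lintegral_const_mul _ (by fun_prop)]
  refine lintegral_mono fun w => ?_
  refine le_trans (le_of_eq ?_) (le_stdNormal_abs_gt (Real.sqrt_nonneg _) hη hη1)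
  rw [Real.sq_sqrt (mul_nonneg hk (Finset.sum_nonneg fun _ _ => sq_nonneg _)),
    ← ENNReal.ofReal_mul (by positivity)]
  congr 3
  ring

lemma pi_residual_eq_zero {d : ℕ} (hd : 0 < d) :
    (Measure.pi fun _ : Fin (d + 2) => stdNormal)
      {g | ∑ j : Fin d, g j.succ.succ ^ 2 = 0} = 0 := by
  have : NullSingletonClass stdNormal := nullSingletonClass_gaussianReal one_ne_zero
  let j₀ : Fin d := ⟨0, hd⟩
  have hmp := measurePreserving_eval (fun _ : Fin (d + 2) => stdNormal) j₀.succ.succ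
  refine measure_mono_null (t := (fun g => g j₀.succ.succ) ⁻¹' {0}) ?_ ?_
  · intro g hg
    have := (Finset.sum_eq_zero_iff_of_nonneg (fun j _ => sq_nonneg (g j.succ.succ))).1 hg j₀
      (Finset.mem_univ _)
    simpa using this
  · have := hmp.measure_preimage (measurableSet_singleton (0 : ℝ)).nullMeasurableSet
    exact this.trans (measure_singleton 0)

lemma inv_sqrt_exp_pow {d : ℕ} (hd : 0 < d) (t : ℝ) :
    (Real.sqrt (Real.exp (t / d)))⁻¹ ^ d = Real.exp (-t / 2) := by
  have hd' : (d : ℝ) ≠ 0 := by exact_mod_cast hd.ne'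
  rw [Real.sqrt_eq_rpow, ← Real.exp_mul, ← Real.exp_neg, ← Real.exp_nat_mul]
  congr 1
  field_simp

section

variable {κ : Type*} [Fintype κ] {d : ℕ}

@[fun_prop]
lemma measurable_logLR_comp {ι α : Type*} [MeasurableSpace α] (R : Finset ι) {x y : α → ι → ℝ}
    (hx : Measurable x) (hy : Measurable y) : Measurable fun a => logLR R (x a) (y a) := by
  unfold logLR pearsonCorr sampleMean
  fun_prop

/-- The tail of the statistic given `x`: the residual sum of squares is a chi-square variable with
`d = |κ| - 2` degrees of freedom, and its Laplace transform turns the Gaussian tail `e^{-z²/2}`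
into exactly `e^{-t/2}`. -/
lemma pi_lt_logLR_le (hd : 0 < d) (hκ : Fintype.card κ = d + 2) (x : κ → ℝ) {t : ℝ} (ht : 0 ≤ t) :
    (Measure.pi fun _ : κ => stdNormal) {y | t < logLR Finset.univ x y} ≤
      ENNReal.ofReal (2 * Real.exp (-t / 2)) := by
  have hd' : (0 : ℝ) < d := by exact_mod_cast hd
  have hcard : ((Finset.univ : Finset κ).card : ℝ) - 2 = d := by
    rw [Finset.card_univ, hκ]; push_cast; ring
  rcases (Finset.sum_nonneg fun i (_ : i ∈ Finset.univ) =>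
    sq_nonneg (x i - sampleMean Finset.univ x)).eq_or_lt with h0 | hx
  · -- a constant `x` gives the correlation `0` by the convention on division by zero
    have : {y : κ → ℝ | t < logLR Finset.univ x y} = ∅ := by
      ext y
      simp only [Set.mem_ofPred_eq, Set.mem_empty_iff_false, iff_false, not_lt]
      unfold logLR pearsonCorr
      rw [← h0]
      simpa using ht
    rw [this]
    simp
  · obtain ⟨T, hT, hTg⟩ := exists_gaussian_coordinates hκ x hx
    have hms : NullMeasurableSet {y | t < logLR Finset.univ x y}
        (Measure.pi fun _ : κ => stdNormal) := by
      exact (measurableSet_lt measurable_const (by fun_prop)).nullMeasurableSet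
    rw [← hT.measure_preimage hms]
    have hk : 0 ≤ Real.exp (t / d) - 1 := by
      linarith [Real.one_le_exp (show 0 ≤ t / d by positivity)]
    refine (measure_mono ?_).trans ((pi_sqrt_lt_abs_le d hk).trans (le_of_eq ?_))
    · intro g hg
      obtain ⟨h1, h2⟩ := hTg g
      refine lt_abs_of_lt_logLR (c := pearsonCorr Finset.univ x (T g)) hx
        (Finset.sum_nonneg fun _ _ => sq_nonneg _) hd' ht ?_ ?_
      · unfold pearsonCorr
        rw [h1, h2]
      · have : t < logLR Finset.univ x (T g) := hg
        unfold logLR at this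
        rwa [hcard] at this
    · rw [add_sub_cancel, inv_sqrt_exp_pow hd]

/-- The matching lower bound. The parameter `η` is free: of the order of `1 / t` it costs only a
power of `t`. -/
lemma le_pi_lt_logLR (hd : 0 < d) (hκ : Fintype.card κ = d + 2) (x : κ → ℝ)
    (hx : 0 < ∑ i, (x i - sampleMean Finset.univ x) ^ 2) {t η : ℝ} (ht : 0 ≤ t)
    (hη : 0 < η) (hη1 : η ≤ 1) :
    ENNReal.ofReal (gaussTailConst * Real.sqrt η * Real.exp (-((1 + η) * t) / 2)) ≤
      (Measure.pi fun _ : κ => stdNormal) {y | t < logLR Finset.univ x y} := by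
  have hd' : (0 : ℝ) < d := by exact_mod_cast hd
  have hcard : ((Finset.univ : Finset κ).card : ℝ) - 2 = d := by
    rw [Finset.card_univ, hκ]; push_cast; ring
  obtain ⟨T, hT, hTg⟩ := exists_gaussian_coordinates hκ x hx
  have hms : NullMeasurableSet {y | t < logLR Finset.univ x y}
      (Measure.pi fun _ : κ => stdNormal) := by
    exact (measurableSet_lt measurable_const (by fun_prop)).nullMeasurableSet
  rw [← hT.measure_preimage hms]
  have hk : 0 ≤ Real.exp (t / d) - 1 := by
    linarith [Real.one_le_exp (show 0 ≤ t / d by positivity)]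
  have hc := gaussTailConst_pos
  refine le_trans (le_trans ?_ (le_pi_sqrt_lt_abs d hk hη hη1)) ?_
  · refine ENNReal.ofReal_le_ofReal (mul_le_mul_of_nonneg_left ?_ (by positivity))
    rw [← inv_sqrt_exp_pow hd]
    -- Bernoulli: `1 + (1 + η) k ≤ (1 + k) ^ (1 + η)`
    have hB := one_add_mul_self_le_rpow_one_add (s := Real.exp (t / d) - 1) (by linarith)
      (p := 1 + η) (by linarith)
    rw [add_sub_cancel, ← Real.exp_mul] at hB
    have he : t / d * (1 + η) = (1 + η) * t / d := by ring
    rw [he] at hB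
    have hpos : 0 < 1 + (1 + η) * (Real.exp (t / d) - 1) := by positivity
    gcongr
  · rw [← measure_sdiff_null (pi_residual_eq_zero hd)]
    refine measure_mono ?_
    rintro g ⟨hg, hg0⟩
    obtain ⟨h1, h2⟩ := hTg g
    have := lt_logLR_of_lt_abs (c := pearsonCorr Finset.univ x (T g)) hx
      (lt_of_le_of_ne (Finset.sum_nonneg fun _ _ => sq_nonneg _) (Ne.symm hg0)) hd' ht
      (by unfold pearsonCorr; rw [h1, h2]) hg
    simp only [Set.mem_preimage, Set.mem_ofPred_eq, logLR]
    rwa [hcard]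

/-- The law of the pairs `(X i, Y i)` under the standardized null model. -/
noncomputable abbrev nullPi (ι : Type*) [Fintype ι] : Measure (ι → ℝ × ℝ) :=
  Measure.pi fun _ => stdNormal.prod stdNormal

lemma nullPi_lt_logLR_univ (t : ℝ) :
    nullPi κ {ω | t < logLR Finset.univ (fun i => (ω i).1) fun i => (ω i).2} =
      ∫⁻ x, (Measure.pi fun _ : κ => stdNormal) {y | t < logLR Finset.univ x y}
        ∂(Measure.pi fun _ : κ => stdNormal) := by
  have hmp := measurePreserving_arrowProdEquivProdArrow ℝ ℝ κ (fun _ => stdNormal)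
    (fun _ => stdNormal)
  have hms : MeasurableSet {p : (κ → ℝ) × (κ → ℝ) | t < logLR Finset.univ p.1 p.2} :=
    measurableSet_lt measurable_const (by fun_prop)
  have h1 := hmp.measure_preimage hms.nullMeasurableSet
  rw [Measure.prod_apply hms] at h1
  exact h1

/-- A standard Gaussian vector almost surely has two different entries. -/
lemma ae_pi_sum_centered_sq_pos (hκ : 2 ≤ Fintype.card κ) :
    ∀ᵐ x ∂(Measure.pi fun _ : κ => stdNormal),
      0 < ∑ i, (x i - sampleMean Finset.univ x) ^ 2 := by
  have : NullSingletonClass stdNormal := nullSingletonClass_gaussianReal one_ne_zero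
  obtain ⟨i, j, hij⟩ := Fintype.exists_pair_of_one_lt_card hκ
  have hind : IndepFun (fun x : κ → ℝ => x i) (fun x => x j) (Measure.pi fun _ => stdNormal) :=
    (iIndepFun_pi (X := fun _ => id) fun _ => aemeasurable_id).indepFun hij
  have hlaw := (indepFun_iff_map_prod_eq_prod_map_map (measurable_pi_apply i).aemeasurable
    (measurable_pi_apply j).aemeasurable).1 hind
  have hdiag : MeasurableSet {p : ℝ × ℝ | p.1 = p.2} :=
    measurableSet_eq_fun (by fun_prop) (by fun_prop)
  have hnull : (Measure.pi fun _ : κ => stdNormal) {x | x i = x j} = 0 := by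
    have h1 := congrArg (fun ν => ν {p : ℝ × ℝ | p.1 = p.2}) hlaw
    have hi : Measure.map (fun x : κ → ℝ => x i) (Measure.pi fun _ => stdNormal) = stdNormal :=
      (measurePreserving_eval _ i).map_eq
    have hj : Measure.map (fun x : κ → ℝ => x j) (Measure.pi fun _ => stdNormal) = stdNormal :=
      (measurePreserving_eval _ j).map_eq
    simp only [hi, hj] at h1
    rw [Measure.map_apply (by fun_prop) hdiag] at h1
    refine h1.trans ((Measure.measure_prod_null hdiag).2 (Eventually.of_forall fun a => ?_))
    have : Prod.mk a ⁻¹' {p : ℝ × ℝ | p.1 = p.2} = {a} := by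
      ext b
      simp [eq_comm]
    simp only [this, measure_singleton, Pi.zero_apply]
  have hae : ∀ᵐ x ∂(Measure.pi fun _ : κ => stdNormal), ¬ x i = x j := by
    rw [ae_iff]
    simpa using hnull
  filter_upwards [hae] with x hx
  refine lt_of_le_of_ne (Finset.sum_nonneg fun _ _ => sq_nonneg _) fun h0 => hx ?_
  have h2 := (Finset.sum_eq_zero_iff_of_nonneg fun i _ =>
    sq_nonneg (x i - sampleMean Finset.univ x)).1 h0.symm
  have hi := pow_eq_zero_iff (two_ne_zero) |>.1 (h2 i (Finset.mem_univ _))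
  have hj := pow_eq_zero_iff (two_ne_zero) |>.1 (h2 j (Finset.mem_univ _))
  linarith

end

section

variable {ι : Type*} [Fintype ι]

lemma measurePreserving_restrict_nullPi (R : Finset ι) :
    MeasurePreserving (fun (ω : ι → ℝ × ℝ) (i : R) => ω i) (nullPi ι) (nullPi R) := by
  have hind : iIndepFun (fun (i : R) (ω : ι → ℝ × ℝ) => ω i) (nullPi ι) :=
    (iIndepFun_pi (X := fun _ => id) fun _ => aemeasurable_id).precomp
      (g := ((↑) : R → ι)) Subtype.val_injective
  have := iIndepFun.hasLaw_pi (X := fun (i : R) (ω : ι → ℝ × ℝ) => ω i)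
    (μ := fun _ => stdNormal.prod stdNormal)
    (fun i => (measurePreserving_eval (fun _ : ι => stdNormal.prod stdNormal) (i : ι)).hasLaw) hind
  exact ⟨by fun_prop, this.map_eq⟩

lemma nullPi_lt_logLR_eq (R : Finset ι) (t : ℝ) :
    nullPi ι {ω | t < logLR R (fun i => (ω i).1) fun i => (ω i).2} =
      nullPi R {ω | t < logLR Finset.univ (fun i => (ω i).1) fun i => (ω i).2} := by
  rw [← (measurePreserving_restrict_nullPi R).measure_preimage
    (measurableSet_lt measurable_const (by fun_prop)).nullMeasurableSet]
  congr 1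
  ext ω
  simp only [Set.mem_preimage, Set.mem_ofPred_eq]
  rw [logLR_eq_univ]

/-- The tail of `L_R` has the exponential rate `1/2` for every region, whatever its size. -/
theorem nullPi_lt_logLR_le {R : Finset ι} (hR : 3 ≤ R.card) {t : ℝ} (ht : 0 ≤ t) :
    nullPi ι {ω | t < logLR R (fun i => (ω i).1) fun i => (ω i).2} ≤
      ENNReal.ofReal (2 * Real.exp (-t / 2)) := by
  rw [nullPi_lt_logLR_eq, nullPi_lt_logLR_univ]
  have hd : 0 < R.card - 2 := by omega
  have hκ : Fintype.card R = (R.card - 2) + 2 := by rw [Fintype.card_coe]; omega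
  refine (lintegral_mono fun x => pi_lt_logLR_le hd hκ x ht).trans (le_of_eq ?_)
  simp

theorem le_nullPi_lt_logLR {R : Finset ι} (hR : 3 ≤ R.card) {t η : ℝ} (ht : 0 ≤ t)
    (hη : 0 < η) (hη1 : η ≤ 1) :
    ENNReal.ofReal (gaussTailConst * Real.sqrt η * Real.exp (-((1 + η) * t) / 2)) ≤
      nullPi ι {ω | t < logLR R (fun i => (ω i).1) fun i => (ω i).2} := by
  rw [nullPi_lt_logLR_eq, nullPi_lt_logLR_univ]
  have hd : 0 < R.card - 2 := by omega
  have hκ : Fintype.card R = (R.card - 2) + 2 := by rw [Fintype.card_coe]; omega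
  have hae := ae_pi_sum_centered_sq_pos (κ := R) (by omega)
  refine le_trans (le_of_eq ?_) (lintegral_mono_ae
    (hae.mono fun x hx => le_pi_lt_logLR hd hκ x hx ht hη hη1))
  simp

end

/-! ### Exponential bounds for sums over a region -/

lemma inv_sqrt_one_sub_le_exp {v : ℝ} (h0 : 0 ≤ v) (h1 : v ≤ 1 / 2) :
    (Real.sqrt (1 - v))⁻¹ ≤ Real.exp (v / 2 + v ^ 2 / 2) := by
  have hs : 0 < Real.sqrt (1 - v) := Real.sqrt_pos.2 (by linarith)
  have hE := Real.quadratic_le_exp_of_nonneg (show 0 ≤ v + v ^ 2 by positivity)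
  have h2 : 1 ≤ (1 - v) * Real.exp (v + v ^ 2) := by
    refine le_trans ?_ (mul_le_mul_of_nonneg_left hE (by linarith))
    have h3 : 0 ≤ v ^ 2 * (1 - v - v ^ 2 - v ^ 3) := by
      refine mul_nonneg (sq_nonneg v) ?_
      nlinarith [mul_le_mul_of_nonneg_left h1 h0, mul_le_mul_of_nonneg_left h1 (sq_nonneg v)]
    nlinarith
  have h4 : Real.exp (v + v ^ 2) = Real.exp (v / 2 + v ^ 2 / 2) ^ 2 := by
    rw [← Real.exp_nat_mul]
    congr 1
    push_cast
    ring
  rw [inv_le_iff_one_le_mul₀' hs]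
  have h5 : 1 ≤ (Real.sqrt (1 - v) * Real.exp (v / 2 + v ^ 2 / 2)) ^ 2 := by
    rwa [mul_pow, Real.sq_sqrt (by linarith), ← h4]
  exact (one_le_sq_iff₀ (by positivity)).1 h5

lemma inv_sqrt_one_add_le_exp {s : ℝ} (hs : 0 ≤ s) :
    (Real.sqrt (1 + 2 * s))⁻¹ ≤ Real.exp (-s + s ^ 2) := by
  have h1 := Real.le_log_one_add_of_nonneg (show 0 ≤ 2 * s by positivity)
  have h2 : 2 * s - 2 * s ^ 2 ≤ 2 * (2 * s) / (2 * s + 2) := by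
    rw [le_div_iff₀ (by positivity)]
    nlinarith [pow_nonneg hs 3]
  have hpos : 0 < Real.sqrt (1 + 2 * s) := Real.sqrt_pos.2 (by positivity)
  rw [← Real.exp_log hpos, ← Real.exp_neg, Real.exp_le_exp, Real.log_sqrt (by positivity)]
  linarith

section

variable {ι : Type*} [Fintype ι]

/-- A two-sided Chernoff bound for `∑ a i X i Y i`. The variance factor `v (1 + s² β)` is the
Gaussian one up to the correction `s² β`, where `β` bounds the squared coefficients. -/
lemma nullPi_lt_abs_sum_mul_le (a : ι → ℝ) {β v s : ℝ} (hβ0 : 0 ≤ β) (hβ : ∀ i, a i ^ 2 ≤ β)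
    (hv : ∑ i, a i ^ 2 ≤ v) (hs : 0 ≤ s) (hsβ : s ^ 2 * β ≤ 1 / 2) (t : ℝ) :
    nullPi ι {ω | t < |∑ i, a i * ((ω i).1 * (ω i).2)|} ≤
      ENNReal.ofReal (2 * Real.exp (s ^ 2 * v / 2 * (1 + s ^ 2 * β) - s * t)) := by
  have key : ∀ e : ℝ, e ^ 2 = 1 →
      nullPi ι {ω | s * t ≤ ∑ i, s * e * a i * ((ω i).1 * (ω i).2)} ≤
        ENNReal.ofReal (Real.exp (s ^ 2 * v / 2 * (1 + s ^ 2 * β) - s * t)) := by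
    intro e he
    have hsq : ∀ i, (s * e * a i) ^ 2 = s ^ 2 * a i ^ 2 := fun i => by
      rw [mul_pow, mul_pow, he, mul_one]
    refine (chernoff_pi (μ := stdNormal.prod stdNormal)
      (ψ := fun i p => s * e * a i * (p.1 * p.2)) (fun i => by fun_prop)
      (κ := fun i => s ^ 2 * a i ^ 2 / 2 * (1 + s ^ 2 * β)) (fun i => ?_) (s * t)).trans ?_
    · have h1 : s ^ 2 * a i ^ 2 ≤ s ^ 2 * β := mul_le_mul_of_nonneg_left (hβ i) (sq_nonneg s)
      have h0 : 0 ≤ s ^ 2 * a i ^ 2 := by positivity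
      rw [lintegral_exp_mul_mul_stdNormal (by rw [hsq]; linarith), hsq]
      refine ENNReal.ofReal_le_ofReal
        ((inv_sqrt_one_sub_le_exp h0 (h1.trans hsβ)).trans (Real.exp_le_exp.2 ?_))
      nlinarith [mul_le_mul_of_nonneg_left h1 h0]
    · refine ENNReal.ofReal_le_ofReal (Real.exp_le_exp.2 ?_)
      rw [← Finset.sum_mul, ← Finset.sum_div, ← Finset.mul_sum]
      gcongr
  have hsub : {ω : ι → ℝ × ℝ | t < |∑ i, a i * ((ω i).1 * (ω i).2)|} ⊆
      {ω | s * t ≤ ∑ i, s * 1 * a i * ((ω i).1 * (ω i).2)} ∪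
        {ω | s * t ≤ ∑ i, s * (-1) * a i * ((ω i).1 * (ω i).2)} := by
    intro ω hω
    have hsum : ∀ e : ℝ, ∑ i, s * e * a i * ((ω i).1 * (ω i).2) =
        s * (e * ∑ i, a i * ((ω i).1 * (ω i).2)) := fun e => by
      simp only [Finset.mul_sum]
      exact Finset.sum_congr rfl fun i _ => by ring
    simp only [Set.mem_union, Set.mem_ofPred_eq, hsum]
    rcases lt_abs.1 (show t < |∑ i, a i * ((ω i).1 * (ω i).2)| from hω) with h | h
    · exact Or.inl (mul_le_mul_of_nonneg_left (by linarith) hs)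
    · exact Or.inr (mul_le_mul_of_nonneg_left (by linarith) hs)
  calc _ ≤ _ := measure_mono hsub
    _ ≤ _ := measure_union_le _ _
    _ ≤ _ := add_le_add (key 1 (by norm_num)) (key (-1) (by norm_num))
    _ = _ := by rw [← ENNReal.ofReal_add (by positivity) (by positivity), two_mul]

/-- The sub-Gaussian regime of the Chernoff bound for `∑ a i X i Y i`: up to the threshold `t`
allowed by `β`, the tail is that of a Gaussian variable of twice the variance. -/
lemma nullPi_lt_abs_sum_mul_le_exp (a : ι → ℝ) {β v t : ℝ} (hβ0 : 0 ≤ β) (hβ : ∀ i, a i ^ 2 ≤ β)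
    (hv0 : 0 < v) (hv : ∑ i, a i ^ 2 ≤ v) (ht : 0 ≤ t) (htβ : t ^ 2 * β ≤ 2 * v ^ 2) :
    nullPi ι {ω | t < |∑ i, a i * ((ω i).1 * (ω i).2)|} ≤
      ENNReal.ofReal (2 * Real.exp (-t ^ 2 / (4 * v))) := by
  have h1 : (t / (2 * v)) ^ 2 * β ≤ 1 / 2 := by
    rw [div_pow, div_mul_eq_mul_div, div_le_iff₀ (by positivity)]
    linarith
  refine (nullPi_lt_abs_sum_mul_le a hβ0 hβ hv (s := t / (2 * v)) (by positivity) h1 t).trans ?_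
  refine ENNReal.ofReal_le_ofReal (mul_le_mul_of_nonneg_left (Real.exp_le_exp.2 ?_) (by norm_num))
  have h2 : (t / (2 * v)) ^ 2 * v / 2 * (1 + (t / (2 * v)) ^ 2 * β) ≤
      (t / (2 * v)) ^ 2 * v / 2 * 2 := by gcongr; linarith
  refine (sub_le_sub_right h2 _).trans (le_of_eq ?_)
  field_simp
  ring

/-- Chernoff's bound for the sum over a region of one coordinate of the pairs, given as a
measure-preserving map `π` onto the standard normal law. -/
lemma nullPi_lt_abs_sum_le {π : ℝ × ℝ → ℝ}
    (hπ : MeasurePreserving π (stdNormal.prod stdNormal) stdNormal) (R : Finset ι) {s : ℝ}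
    (hs : 0 ≤ s) (t : ℝ) :
    nullPi ι {ω | t < |∑ i ∈ R, π (ω i)|} ≤
      ENNReal.ofReal (2 * Real.exp (R.card * s ^ 2 / 2 - s * t)) := by
  classical
  have hπm := hπ.measurable
  have key : ∀ e : ℝ, e ^ 2 = 1 →
      nullPi ι {ω | s * t ≤ ∑ i, if i ∈ R then s * e * π (ω i) else 0} ≤
        ENNReal.ofReal (Real.exp (R.card * s ^ 2 / 2 - s * t)) := by
    intro e he
    refine (chernoff_pi (μ := stdNormal.prod stdNormal)
      (ψ := fun i p => if i ∈ R then s * e * π p else 0)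
      (fun i => by by_cases h : i ∈ R <;> simp only [h, if_true, if_false] <;> fun_prop)
      (κ := fun i => if i ∈ R then s ^ 2 / 2 else 0) (fun i => ?_) (s * t)).trans (le_of_eq ?_)
    · by_cases h : i ∈ R
      · simp only [h, if_true]
        have := hπ.lintegral_comp
          (f := fun z => ENNReal.ofReal (Real.exp (s * e * z))) (by fun_prop)
        rw [this, lintegral_exp_mul_stdNormal, mul_pow, he, mul_one]
      · simp [h]
    · rw [Finset.sum_ite_mem, Finset.univ_inter, Finset.sum_const, nsmul_eq_mul, mul_div_assoc]
  have hsub : {ω : ι → ℝ × ℝ | t < |∑ i ∈ R, π (ω i)|} ⊆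
      {ω | s * t ≤ ∑ i, if i ∈ R then s * 1 * π (ω i) else 0} ∪
        {ω | s * t ≤ ∑ i, if i ∈ R then s * (-1) * π (ω i) else 0} := by
    intro ω hω
    have hsum : ∀ e : ℝ, (∑ i, if i ∈ R then s * e * π (ω i) else 0) =
        s * (e * ∑ i ∈ R, π (ω i)) := fun e => by
      rw [Finset.sum_ite_mem, Finset.univ_inter, ← Finset.mul_sum, mul_assoc]
    simp only [Set.mem_union, Set.mem_ofPred_eq, hsum]
    rcases lt_abs.1 (show t < |∑ i ∈ R, π (ω i)| from hω) with h | h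
    · exact Or.inl (mul_le_mul_of_nonneg_left (by linarith) hs)
    · exact Or.inr (mul_le_mul_of_nonneg_left (by linarith) hs)
  calc _ ≤ _ := measure_mono hsub
    _ ≤ _ := measure_union_le _ _
    _ ≤ _ := add_le_add (key 1 (by norm_num)) (key (-1) (by norm_num))
    _ = _ := by rw [← ENNReal.ofReal_add (by positivity) (by positivity), two_mul]

/-- The lower tail of the chi-square variable `∑ i ∈ R, X i ^ 2`. -/
lemma nullPi_sum_sq_le {π : ℝ × ℝ → ℝ}
    (hπ : MeasurePreserving π (stdNormal.prod stdNormal) stdNormal) (R : Finset ι) {s : ℝ}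
    (hs : 0 ≤ s) (t : ℝ) :
    nullPi ι {ω | ∑ i ∈ R, π (ω i) ^ 2 < R.card - t} ≤
      ENNReal.ofReal (Real.exp (R.card * s ^ 2 - s * t)) := by
  classical
  have hπm := hπ.measurable
  have hsub : {ω : ι → ℝ × ℝ | ∑ i ∈ R, π (ω i) ^ 2 < R.card - t} ⊆
      {ω | -s * (R.card - t) ≤ ∑ i, if i ∈ R then -s * π (ω i) ^ 2 else 0} := by
    intro ω hω
    have hω' : ∑ i ∈ R, π (ω i) ^ 2 < R.card - t := hω
    simp only [Set.mem_ofPred_eq]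
    rw [Finset.sum_ite_mem, Finset.univ_inter, ← Finset.mul_sum]
    nlinarith
  refine (measure_mono hsub).trans ((chernoff_pi (μ := stdNormal.prod stdNormal)
      (ψ := fun i p => if i ∈ R then -s * π p ^ 2 else 0)
      (fun i => by by_cases h : i ∈ R <;> simp only [h, if_true, if_false] <;> fun_prop)
      (κ := fun i => if i ∈ R then -s + s ^ 2 else 0) (fun i => ?_) _).trans (le_of_eq ?_))
  · by_cases h : i ∈ R
    · simp only [h, if_true]
      have := hπ.lintegral_comp
        (f := fun z => ENNReal.ofReal (Real.exp (-s * z ^ 2))) (by fun_prop)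
      rw [this, lintegral_exp_neg_sq_stdNormal (by linarith)]
      exact ENNReal.ofReal_le_ofReal (inv_sqrt_one_add_le_exp hs)
    · simp [h]
  · rw [Finset.sum_ite_mem, Finset.univ_inter, Finset.sum_const, nsmul_eq_mul]
    congr 2
    ring

end

/-! ### The sample covariance process and its metric -/

lemma mem_regionsOfSize {ι : Type*} {𝓡 : Finset (Finset ι)} {A : ℝ} {R : Finset ι} :
    R ∈ regionsOfSize 𝓡 A ↔ R ∈ 𝓡 ∧ A / 2 < R.card ∧ (R.card : ℝ) ≤ A := by
  simp [regionsOfSize]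

section

variable {ι : Type*} [DecidableEq ι]

/-- The normalized indicator `|R|^{-1/2} 1_R` of a region. -/
noncomputable def normIndicator (R : Finset ι) (i : ι) : ℝ :=
  if i ∈ R then (Real.sqrt R.card)⁻¹ else 0

/-- The uncentered sample covariance `|R|^{-1/2} ∑ i ∈ R, X i Y i`, a process indexed by regions. -/
noncomputable def crossSum [Fintype ι] (R : Finset ι) (ω : ι → ℝ × ℝ) : ℝ :=
  ∑ i, normIndicator R i * ((ω i).1 * (ω i).2)

lemma normIndicator_nonneg (R : Finset ι) (i : ι) : 0 ≤ normIndicator R i := by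
  unfold normIndicator
  split_ifs <;> positivity

lemma normIndicator_sq_le {R : Finset ι} {B : ℝ} (hB : 0 < B) (hR : B ≤ R.card) (i : ι) :
    normIndicator R i ^ 2 ≤ 1 / B := by
  unfold normIndicator
  split_ifs
  · rw [inv_pow, Real.sq_sqrt (by positivity), one_div]
    exact inv_anti₀ hB hR
  · simp [hB.le]

lemma normIndicator_sub_sq_le {R R' : Finset ι} {B : ℝ} (hB : 0 < B) (hR : B ≤ R.card)
    (hR' : B ≤ R'.card) (i : ι) : (normIndicator R i - normIndicator R' i) ^ 2 ≤ 1 / B := by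
  have h1 := normIndicator_sq_le hB hR i
  have h2 := normIndicator_sq_le hB hR' i
  have h3 := normIndicator_nonneg R i
  have h4 := normIndicator_nonneg R' i
  rcases le_total (normIndicator R i) (normIndicator R' i) with h | h <;> nlinarith

variable [Fintype ι]

lemma sum_normIndicator_mul (R R' : Finset ι) :
    ∑ i, normIndicator R i * normIndicator R' i = 1 - regionDist R R' := by
  have h : ∀ i, normIndicator R i * normIndicator R' i =
      if i ∈ R ∩ R' then (Real.sqrt R.card)⁻¹ * (Real.sqrt R'.card)⁻¹ else 0 := by
    intro i
    unfold normIndicator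
    by_cases h1 : i ∈ R <;> by_cases h2 : i ∈ R' <;> simp [h1, h2]
  simp_rw [h]
  rw [Finset.sum_ite_mem, Finset.univ_inter, Finset.sum_const, nsmul_eq_mul]
  unfold regionDist
  rw [Real.sqrt_mul (Nat.cast_nonneg _), ← mul_inv]
  ring

lemma sum_normIndicator_sq {R : Finset ι} (hR : R.Nonempty) :
    ∑ i, normIndicator R i ^ 2 = 1 := by
  have hc : (0 : ℝ) < R.card := by exact_mod_cast hR.card_pos
  have h : ∀ i, normIndicator R i ^ 2 = if i ∈ R then ((R.card : ℝ))⁻¹ else 0 := by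
    intro i
    unfold normIndicator
    split_ifs
    · rw [inv_pow, Real.sq_sqrt hc.le]
    · simp
  simp_rw [h]
  rw [Finset.sum_ite_mem, Finset.univ_inter, Finset.sum_const, nsmul_eq_mul, mul_inv_cancel₀ hc.ne']

/-- The dissimilarity is half the squared Euclidean distance of the normalized indicators. -/
lemma sum_normIndicator_sub_sq {R R' : Finset ι} (hR : R.Nonempty) (hR' : R'.Nonempty) :
    ∑ i, (normIndicator R i - normIndicator R' i) ^ 2 = 2 * regionDist R R' := by
  have h : ∀ i, (normIndicator R i - normIndicator R' i) ^ 2 =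
      normIndicator R i ^ 2 + normIndicator R' i ^ 2
        - 2 * (normIndicator R i * normIndicator R' i) := fun i => by ring
  simp_rw [h, Finset.sum_sub_distrib, Finset.sum_add_distrib, ← Finset.mul_sum]
  rw [sum_normIndicator_sq hR, sum_normIndicator_sq hR', sum_normIndicator_mul]
  ring

lemma regionDist_le_two_mul_add {R S R' : Finset ι} (hR : R.Nonempty) (hS : S.Nonempty)
    (hR' : R'.Nonempty) : regionDist R R' ≤ 2 * (regionDist R S + regionDist R' S) := by
  have h1 := sum_normIndicator_sub_sq hR hR'
  have h2 := sum_normIndicator_sub_sq hR hS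
  have h3 := sum_normIndicator_sub_sq hR' hS
  have h4 : ∑ i, (normIndicator R i - normIndicator R' i) ^ 2 ≤
      2 * (∑ i, (normIndicator R i - normIndicator S i) ^ 2
        + ∑ i, (normIndicator R' i - normIndicator S i) ^ 2) := by
    rw [← Finset.sum_add_distrib, Finset.mul_sum]
    refine Finset.sum_le_sum fun i _ => ?_
    nlinarith [sq_nonneg (normIndicator R i + normIndicator R' i - 2 * normIndicator S i)]
  linarith

lemma regionDist_self {R : Finset ι} (hR : R.Nonempty) : regionDist R R = 0 := by
  have h := sum_normIndicator_sub_sq hR hR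
  simp at h
  exact h

lemma crossSum_sub (R R' : Finset ι) (ω : ι → ℝ × ℝ) :
    crossSum R ω - crossSum R' ω =
      ∑ i, (normIndicator R i - normIndicator R' i) * ((ω i).1 * (ω i).2) := by
  unfold crossSum
  rw [← Finset.sum_sub_distrib]
  exact Finset.sum_congr rfl fun i _ => by ring

lemma sqrt_card_mul_crossSum {R : Finset ι} (hR : R.Nonempty) (ω : ι → ℝ × ℝ) :
    Real.sqrt R.card * crossSum R ω = ∑ i ∈ R, (ω i).1 * (ω i).2 := by
  have hc : Real.sqrt R.card ≠ 0 :=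
    (Real.sqrt_pos.2 (by exact_mod_cast hR.card_pos)).ne'
  unfold crossSum normIndicator
  simp_rw [ite_mul, zero_mul]
  rw [Finset.sum_ite_mem, Finset.univ_inter, ← Finset.mul_sum, mul_inv_cancel_left₀ hc]

/-- A covering by regions of arbitrary size can be replaced by one with centers in `𝓡(A)`, at the
cost of a factor `4` in the radius. -/
lemma exists_internal_net {𝓡 : Finset (Finset ι)} {A ε : ℝ} (hA : 0 ≤ A) (h0 : 0 < ε)
    (h1 : ε < 1) :
    ∃ T ⊆ regionsOfSize 𝓡 A, T.card ≤ coveringNumber 𝓡 A ε ∧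
      ∀ R ∈ regionsOfSize 𝓡 A, ∃ R' ∈ T, regionDist R R' ≤ 4 * ε := by
  have hne : ∀ R ∈ regionsOfSize 𝓡 A, R.Nonempty := by
    intro R hR
    have h2 := (mem_regionsOfSize.1 hR).2.1
    have h3 : (0 : ℝ) < R.card := by linarith
    exact Finset.card_pos.1 (by exact_mod_cast h3)
  have hset : {m : ℕ | ∃ S : Finset (Finset ι), S ⊆ 𝓡 ∧ S.card = m ∧
      ∀ R₁ ∈ regionsOfSize 𝓡 A, ∃ R₂ ∈ S, regionDist R₁ R₂ ≤ ε}.Nonempty := by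
    refine ⟨𝓡.card, 𝓡, Finset.Subset.refl _, rfl, fun R hR => ⟨R, ?_, ?_⟩⟩
    · exact (mem_regionsOfSize.1 hR).1
    · rw [regionDist_self (hne R hR)]
      exact h0.le
  obtain ⟨S, -, hcard, hS⟩ := Nat.sInf_mem hset
  choose! c hc using hS
  -- a center that serves some region of `𝓡(A)` is replaced by one such region
  have hinv : ∀ C ∈ (regionsOfSize 𝓡 A).image c, ∃ R ∈ regionsOfSize 𝓡 A, c R = C := by
    intro C hC
    simpa using hC
  choose! f hf using hinv
  refine ⟨((regionsOfSize 𝓡 A).image c).image f, ?_, ?_, ?_⟩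
  · intro R hR
    obtain ⟨C, hC, rfl⟩ := Finset.mem_image.1 hR
    exact (hf C hC).1
  · refine Finset.card_image_le.trans ((Finset.card_le_card ?_).trans hcard.le)
    intro C hC
    obtain ⟨R, hR, rfl⟩ := Finset.mem_image.1 hC
    exact (hc R hR).1
  · intro R hR
    have hcR := Finset.mem_image_of_mem c hR
    obtain ⟨hfR, hfc⟩ := hf _ hcR
    refine ⟨f (c R), Finset.mem_image_of_mem f hcR, ?_⟩
    have h2 := (hc R hR).2
    have h3 := (hc _ hfR).2
    rw [hfc] at h3
    have hcne : (c R).Nonempty := by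
      rw [Finset.nonempty_iff_ne_empty]
      intro h
      rw [h] at h2
      simp [regionDist] at h2
      linarith
    have := regionDist_le_two_mul_add (hne R hR) hcne (hne _ hfR)
    linarith

/-- The sub-Gaussian increments of the sample covariance process over `𝓡(A)`. -/
lemma nullPi_lt_abs_crossSum_sub_le {R R' : Finset ι} {A v t : ℝ} (hA : 0 < A)
    (hR : A / 2 < R.card) (hR' : A / 2 < R'.card) (hv0 : 0 < v) (hv : 2 * regionDist R R' ≤ v)
    (ht : 0 ≤ t) (htA : t ^ 2 ≤ v ^ 2 * A) :
    nullPi ι {ω | t < |crossSum R ω - crossSum R' ω|} ≤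
      ENNReal.ofReal (2 * Real.exp (-t ^ 2 / (4 * v))) := by
  have hne : ∀ {S : Finset ι}, A / 2 < S.card → S.Nonempty := by
    intro S hS
    have : (0 : ℝ) < S.card := by linarith
    exact Finset.card_pos.1 (by exact_mod_cast this)
  simp_rw [crossSum_sub]
  refine nullPi_lt_abs_sum_mul_le_exp _ (β := 1 / (A / 2)) (by positivity)
    (normIndicator_sub_sq_le (by positivity) hR.le hR'.le) hv0 ?_ ht ?_
  · rw [sum_normIndicator_sub_sq (hne hR) (hne hR')]
    exact hv
  · rw [mul_one_div, div_le_iff₀ (by positivity)]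
    linarith

/-- The tail of the sample covariance of one region, with the exact Gaussian exponent. -/
lemma nullPi_lt_abs_crossSum_le {R : Finset ι} {A t : ℝ} (hA : 0 < A) (hR : A / 2 < R.card)
    (ht : 0 ≤ t) (htA : t ^ 4 ≤ A) (htA' : 4 * t ^ 2 ≤ A) :
    nullPi ι {ω | t < |crossSum R ω|} ≤ ENNReal.ofReal (2 * Real.exp (1 - t ^ 2 / 2)) := by
  have hne : R.Nonempty := by
    have : (0 : ℝ) < R.card := by linarith
    exact Finset.card_pos.1 (by exact_mod_cast this)
  have h1 : t ^ 2 * (1 / (A / 2)) ≤ 1 / 2 := by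
    rw [mul_one_div, div_le_iff₀ (by positivity)]
    linarith
  refine (nullPi_lt_abs_sum_mul_le (normIndicator R) (β := 1 / (A / 2)) (by positivity)
    (normIndicator_sq_le (by positivity) hR.le) (sum_normIndicator_sq hne).le ht h1 t).trans ?_
  refine ENNReal.ofReal_le_ofReal (mul_le_mul_of_nonneg_left (Real.exp_le_exp.2 ?_) (by norm_num))
  have h2 : t ^ 4 / A ≤ 1 := (div_le_one hA).2 htA
  have h3 : t ^ 2 * 1 / 2 * (1 + t ^ 2 * (1 / (A / 2))) - t * t = t ^ 4 / A - t ^ 2 / 2 := by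
    field_simp
    ring
  linarith

end

/-! ### Chaining -/

/-- One step of a chaining argument: a finite family `S` of random variables, each close to a
member of `T`, is bounded by the bound for `T` plus the bound for the increments. -/
lemma measure_exists_lt_abs_le_of_net {Ω β : Type*} [MeasurableSpace Ω] {μ : Measure Ω}
    {W : β → Ω → ℝ} {S T : Finset β} {w t p q : ℝ} (hq : 0 ≤ q) (hp : 0 ≤ p)
    (hT : μ {ω | ∃ R ∈ T, w < |W R ω|} ≤ ENNReal.ofReal p)
    (hS : ∀ R ∈ S, ∃ R' ∈ T, μ {ω | t < |W R ω - W R' ω|} ≤ ENNReal.ofReal q) :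
    μ {ω | ∃ R ∈ S, w + t < |W R ω|} ≤ ENNReal.ofReal (p + S.card * q) := by
  choose! π hπT hπ using hS
  have hsub : {ω | ∃ R ∈ S, w + t < |W R ω|} ⊆
      {ω | ∃ R ∈ T, w < |W R ω|} ∪ {ω | ∃ R ∈ S, t < |W R ω - W (π R) ω|} := by
    rintro ω ⟨R, hR, hω⟩
    by_cases h : t < |W R ω - W (π R) ω|
    · exact Or.inr ⟨R, hR, h⟩
    · left
      refine ⟨π R, hπT R hR, ?_⟩
      have := abs_sub_abs_le_abs_sub (W R ω) (W (π R) ω)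
      linarith
  refine (measure_mono hsub).trans ((measure_union_le _ _).trans ?_)
  rw [ENNReal.ofReal_add hp (by positivity)]
  exact add_le_add hT (measure_exists_mem_le hπ)

/-- Chaining through the nets `T 0, …, T J`, with thresholds `t j` for the increments. -/
lemma measure_exists_lt_abs_le_of_nets {Ω β : Type*} [MeasurableSpace Ω] {μ : Measure Ω}
    {W : β → Ω → ℝ} {T : ℕ → Finset β} {w p₀ : ℝ} {t p q : ℕ → ℝ} (hq : ∀ j, 0 ≤ q j)
    (hp₀ : 0 ≤ p₀) (hT : μ {ω | ∃ R ∈ T 0, w < |W R ω|} ≤ ENNReal.ofReal p₀) (J : ℕ)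
    (hS : ∀ j < J, ∀ R ∈ T (j + 1), ∃ R' ∈ T j,
      μ {ω | t j < |W R ω - W R' ω|} ≤ ENNReal.ofReal (q j))
    (hp : ∀ j < J, (T (j + 1)).card * q j ≤ p j) :
    μ {ω | ∃ R ∈ T J, w + ∑ j ∈ Finset.range J, t j < |W R ω|} ≤
      ENNReal.ofReal (p₀ + ∑ j ∈ Finset.range J, p j) := by
  induction J with
  | zero => simpa using hT
  | succ J ih =>
    have h1 := ih (fun j hj => hS j (by omega)) (fun j hj => hp j (by omega))
    have hp0 : ∀ j < J + 1, 0 ≤ p j := fun j hj =>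
      le_trans (mul_nonneg (Nat.cast_nonneg _) (hq j)) (hp j hj)
    have h2 := measure_exists_lt_abs_le_of_net (hq J)
      (add_nonneg hp₀ (Finset.sum_nonneg fun j hj => hp0 j (by
        have := Finset.mem_range.1 hj
        omega))) h1 (hS J (by omega))
    rw [Finset.sum_range_succ, Finset.sum_range_succ, ← add_assoc, ← add_assoc]
    refine h2.trans (ENNReal.ofReal_le_ofReal ?_)
    linarith [hp J (by omega)]

/-! ### From the sample covariance to the statistic -/

/-- If the sample means and variances of a region are close to their expectations, then `L_R`
exceeds the squared sample covariance by a bounded amount at most. -/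
lemma logLR_le_sq_add_three {ι : Type*} {R : Finset ι} {x y : ι → ℝ} {w b τ : ℝ} (hw : 0 ≤ w)
    (hτ : 0 < τ) (hR : R.Nonempty)
    (hxy : |∑ i ∈ R, x i * y i| ≤ Real.sqrt R.card * w)
    (hx : |∑ i ∈ R, x i| ≤ b) (hy : |∑ i ∈ R, y i| ≤ b)
    (hxx : R.card - b ≤ ∑ i ∈ R, x i ^ 2) (hyy : R.card - b ≤ ∑ i ∈ R, y i ^ 2)
    (hbτ : b ^ 2 ≤ τ * (R.card * Real.sqrt R.card)) (hbτ' : b + b ^ 2 / R.card ≤ τ * R.card)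
    (hwτ : τ * (w ^ 2 + 1) ≤ 1 / 4) (hwm : 2 * (w ^ 2 + 2) ^ 2 ≤ R.card) :
    logLR R x y ≤ w ^ 2 + 3 := by
  set m : ℝ := (R.card : ℝ) with hm
  have hm0 : 0 < m := by positivity
  have hb : 0 ≤ b := (abs_nonneg _).trans hx
  have hτ4 : τ ≤ 1 / 4 := by nlinarith [sq_nonneg w]
  set S := ∑ i ∈ R, (x i - sampleMean R x) * (y i - sampleMean R y) with hS
  set Nx := ∑ i ∈ R, (x i - sampleMean R x) ^ 2 with hNx
  set Ny := ∑ i ∈ R, (y i - sampleMean R y) ^ 2 with hNy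
  have hSm : |S| ≤ Real.sqrt m * (w + τ) := by
    rw [hS, sum_centered_mul hR, ← hm]
    refine (abs_sub _ _).trans ?_
    rw [abs_div, abs_mul, abs_of_pos hm0, mul_add]
    refine add_le_add hxy ?_
    rw [div_le_iff₀ hm0]
    calc |∑ i ∈ R, x i| * |∑ i ∈ R, y i| ≤ b * b := mul_le_mul hx hy (abs_nonneg _) hb
      _ ≤ τ * (m * Real.sqrt m) := by rw [← sq]; exact hbτ
      _ = Real.sqrt m * τ * m := by ring
  have hN : ∀ z : ι → ℝ, |∑ i ∈ R, z i| ≤ b → m - b ≤ ∑ i ∈ R, z i ^ 2 →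
      m * (1 - τ) ≤ ∑ i ∈ R, (z i - sampleMean R z) ^ 2 := by
    intro z hz hzz
    rw [sum_centered_sq hR, ← hm]
    have h1 : (∑ i ∈ R, z i) ^ 2 / m ≤ b ^ 2 / m := by
      exact div_le_div_of_nonneg_right (sq_le_sq' (abs_le.1 hz).1 (abs_le.1 hz).2) hm0.le
    linarith
  have hNx1 := hN x hx hxx
  have hNy1 := hN y hy hyy
  have hmτ : 0 < m * (1 - τ) := mul_pos hm0 (by linarith)
  set v := pearsonCorr R x y ^ 2 with hv
  have hvm : v * m ≤ w ^ 2 + 2 := by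
    have h1 : v = S ^ 2 / (Nx * Ny) := by
      rw [hv, pearsonCorr, div_pow, Real.sq_sqrt (mul_nonneg (by linarith) (by linarith))]
    have h2 : S ^ 2 ≤ m * (w + τ) ^ 2 := by
      have := sq_le_sq' (abs_le.1 hSm).1 (abs_le.1 hSm).2
      rwa [mul_pow, Real.sq_sqrt hm0.le] at this
    have h3 : m * (1 - τ) * (m * (1 - τ)) ≤ Nx * Ny :=
      mul_le_mul hNx1 hNy1 hmτ.le (by linarith)
    have h4 : v ≤ m * (w + τ) ^ 2 / (m * (1 - τ) * (m * (1 - τ))) := by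
      rw [h1]
      gcongr
    have h5 : (w + τ) ^ 2 ≤ (w ^ 2 + 2) * (1 - τ) ^ 2 := by
      have hwτ' : w * τ ≤ 1 / 4 := by nlinarith [sq_nonneg (w - 1)]
      nlinarith [sq_nonneg w, sq_nonneg τ, mul_nonneg (sq_nonneg w) (sq_nonneg τ)]
    calc v * m ≤ m * (w + τ) ^ 2 / (m * (1 - τ) * (m * (1 - τ))) * m := by gcongr
      _ = (w + τ) ^ 2 / (1 - τ) ^ 2 := by
        have : 1 - τ ≠ 0 := by linarith
        field_simp
      _ ≤ w ^ 2 + 2 := by rwa [div_le_iff₀ (by nlinarith)]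
  have hv0 : 0 ≤ v := sq_nonneg _
  have hv4 : v ≤ 1 / 4 := by
    have h1 : 4 * (w ^ 2 + 2) ≤ m := by
      refine le_trans ?_ hwm
      rw [sq (w ^ 2 + 2), ← mul_assoc]
      have h3 : 0 ≤ w ^ 2 := sq_nonneg w
      gcongr
      linarith
    have h2 : v * m ≤ 1 / 4 * m := by linarith
    exact le_of_mul_le_mul_right h2 hm0
  have hexp : logLR R x y = (m - 2) * -Real.log (1 - v) := by
    unfold logLR
    rw [← hm, ← hv]
    ring
  clear_value v m
  have hlog := Real.one_sub_inv_le_log_of_pos (show 0 < 1 - v by linarith)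
  have hinv : (1 - v)⁻¹ ≤ 1 + v + 2 * v ^ 2 := by
    rw [inv_le_iff_one_le_mul₀ (by linarith)]
    nlinarith [mul_nonneg (sq_nonneg v) hv0]
  have hlog' : -Real.log (1 - v) ≤ v + 2 * v ^ 2 := by linarith
  have hm2 : 0 ≤ m - 2 := by
    have h8 : (2 : ℝ) ^ 2 ≤ (w ^ 2 + 2) ^ 2 := by
      gcongr
      linarith [sq_nonneg w]
    linarith
  have hv2 : 2 * v ^ 2 * m ≤ 1 := by
    have h1 : (v * m) ^ 2 ≤ (w ^ 2 + 2) ^ 2 := by gcongr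
    have h2 : 2 * v ^ 2 * m * m ≤ 1 * m := by
      calc 2 * v ^ 2 * m * m = 2 * (v * m) ^ 2 := by ring
        _ ≤ 1 * m := by linarith
    exact le_of_mul_le_mul_right h2 hm0
  rw [hexp]
  have h6 := mul_le_mul_of_nonneg_left hlog' hm2
  have h7 : 0 ≤ v + 2 * v ^ 2 := by positivity
  linarith

/-! ### The upper bound for large regions -/

section

variable {ι : Type*} [Fintype ι]

/-- The sample moments of order one and two of all regions of size about `A = a ^ 16` are close to
their expectations. -/
lemma nullPi_exists_moments_le (𝓡 : Finset (Finset ι)) {a : ℝ} (ha : 1 ≤ a) :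
    nullPi ι {ω | ∃ R ∈ regionsOfSize 𝓡 (a ^ 16),
      a ^ 9 < |∑ i ∈ R, (ω i).1| ∨ a ^ 9 < |∑ i ∈ R, (ω i).2| ∨
      ∑ i ∈ R, (ω i).1 ^ 2 < R.card - a ^ 9 ∨ ∑ i ∈ R, (ω i).2 ^ 2 < R.card - a ^ 9} ≤
    ENNReal.ofReal ((regionsOfSize 𝓡 (a ^ 16)).card * (6 * Real.exp (-a ^ 2 / 4))) := by
  have ha0 : 0 < a := by linarith
  have hone : ∀ R ∈ regionsOfSize 𝓡 (a ^ 16), nullPi ι {ω |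
      a ^ 9 < |∑ i ∈ R, (ω i).1| ∨ a ^ 9 < |∑ i ∈ R, (ω i).2| ∨
      ∑ i ∈ R, (ω i).1 ^ 2 < R.card - a ^ 9 ∨ ∑ i ∈ R, (ω i).2 ^ 2 < R.card - a ^ 9} ≤
      ENNReal.ofReal (6 * Real.exp (-a ^ 2 / 4)) := by
    intro R hR
    have hRA := (mem_regionsOfSize.1 hR).2.2
    set s : ℝ := (2 * a ^ 7)⁻¹ with hs
    have hs0 : 0 ≤ s := by positivity
    have hsa : s * a ^ 9 = a ^ 2 / 2 := by
      rw [hs]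
      field_simp
    have hms : R.card * s ^ 2 ≤ a ^ 2 / 4 := by
      calc (R.card : ℝ) * s ^ 2 ≤ a ^ 16 * s ^ 2 := by gcongr
        _ = a ^ 2 / 4 := by
          rw [hs]
          field_simp
          ring
    have hms0 : 0 ≤ R.card * s ^ 2 := by positivity
    have hE1 : Real.exp (R.card * s ^ 2 / 2 - s * a ^ 9) ≤ Real.exp (-a ^ 2 / 4) :=
      Real.exp_le_exp.2 (by rw [hsa]; linarith)
    have hE2 : Real.exp (R.card * s ^ 2 - s * a ^ 9) ≤ Real.exp (-a ^ 2 / 4) :=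
      Real.exp_le_exp.2 (by rw [hsa]; linarith)
    have h1 := nullPi_lt_abs_sum_le (ι := ι) measurePreserving_fst R hs0 (a ^ 9)
    have h2 := nullPi_lt_abs_sum_le (ι := ι) measurePreserving_snd R hs0 (a ^ 9)
    have h3 := nullPi_sum_sq_le (ι := ι) measurePreserving_fst R hs0 (a ^ 9)
    have h4 := nullPi_sum_sq_le (ι := ι) measurePreserving_snd R hs0 (a ^ 9)
    refine (measure_union_le _ _).trans ((add_le_add h1 ((measure_union_le _ _).trans
      (add_le_add h2 ((measure_union_le _ _).trans (add_le_add h3 h4))))).trans ?_)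
    rw [← ENNReal.ofReal_add (by positivity) (by positivity),
      ← ENNReal.ofReal_add (by positivity) (by positivity),
      ← ENNReal.ofReal_add (by positivity) (by positivity)]
    exact ENNReal.ofReal_le_ofReal (by linarith)
  exact measure_exists_mem_le hone

/-- On the event that the moments are controlled, a bound for the sample covariance of a region of
size about `A = a ^ 16` bounds `L_R`. -/
lemma logLR_le_of_moments [DecidableEq ι] {R : Finset ι} {ω : ι → ℝ × ℝ} {a w : ℝ} (ha : 4 ≤ a)
    (hw0 : 0 ≤ w) (hR : a ^ 16 / 2 < R.card) (hw : |crossSum R ω| ≤ w)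
    (hwa : 4 * (w ^ 2 + 2) ≤ a ^ 4)
    (hm : ¬ (a ^ 9 < |∑ i ∈ R, (ω i).1| ∨ a ^ 9 < |∑ i ∈ R, (ω i).2| ∨
      ∑ i ∈ R, (ω i).1 ^ 2 < R.card - a ^ 9 ∨ ∑ i ∈ R, (ω i).2 ^ 2 < R.card - a ^ 9)) :
    logLR R (fun i => (ω i).1) (fun i => (ω i).2) ≤ w ^ 2 + 3 := by
  simp only [not_or, not_lt] at hm
  obtain ⟨h1, h2, h3, h4⟩ := hm
  have ha0 : 0 < a := by linarith
  have hne : R.Nonempty := by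
    have : (0 : ℝ) < R.card := lt_of_le_of_lt (by positivity) hR
    exact Finset.card_pos.1 (by exact_mod_cast this)
  have hm0 : (0 : ℝ) < R.card := by exact_mod_cast hne.card_pos
  have hsq : a ^ 8 / 2 ≤ Real.sqrt R.card := by
    refine Real.le_sqrt_of_sq_le ?_
    nlinarith [pow_pos ha0 16]
  have ha2 : 16 ≤ a ^ 2 := by nlinarith
  refine logLR_le_sq_add_three (b := a ^ 9) (τ := (a ^ 4)⁻¹) hw0 (by positivity) hne ?_ h1 h2 h3 h4
    ?_ ?_ ?_ ?_
  · rw [← sqrt_card_mul_crossSum hne, abs_mul, abs_of_nonneg (Real.sqrt_nonneg _)]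
    gcongr
  · -- `|R|^{3/2} ≥ a^24 / 4`, to be compared with `a^22`
    rw [inv_mul_eq_div, le_div_iff₀ (by positivity)]
    have h5 : a ^ 16 / 2 * (a ^ 8 / 2) ≤ R.card * Real.sqrt R.card := by gcongr
    have h6 : a ^ 22 * 16 ≤ a ^ 22 * a ^ 2 := by gcongr
    nlinarith [pow_pos ha0 22]
  · rw [inv_mul_eq_div, le_div_iff₀ (by positivity)]
    have h5 : (a ^ 9) ^ 2 / R.card ≤ 2 * a ^ 2 := by
      rw [div_le_iff₀ hm0]
      nlinarith [pow_pos ha0 2]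
    have h6 : a ^ 2 ≤ a ^ 9 := pow_le_pow_right₀ (by linarith) (by norm_num)
    have h7 : (a ^ 9 + (a ^ 9) ^ 2 / R.card) * a ^ 4 ≤ 3 * a ^ 9 * a ^ 4 := by gcongr; linarith
    have h8 : a ^ 13 * 16 ≤ a ^ 13 * a ^ 3 := by
      gcongr
      nlinarith
    nlinarith [pow_pos ha0 13]
  · rw [inv_mul_eq_div, div_le_iff₀ (by positivity)]
    linarith
  · have h5 : (4 * (w ^ 2 + 2)) ^ 2 ≤ (a ^ 4) ^ 2 := by gcongr
    have h6 : a ^ 8 * 1 ≤ a ^ 8 * a ^ 8 := by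
      gcongr
      exact one_le_pow₀ (by linarith)
    nlinarith

end

lemma exp_neg_mul_succ_le {D : ℝ} (hD : 1 ≤ D) (j : ℕ) :
    Real.exp (-D * (j + 1)) ≤ Real.exp (-D) * (1 / 2) ^ j := by
  have h1 : Real.exp (-1) ≤ 1 / 2 := by
    rw [Real.exp_neg, ← one_div]
    exact one_div_le_one_div_of_le (by norm_num) (by linarith [Real.add_one_le_exp (1 : ℝ)])
  calc Real.exp (-D * (j + 1)) = Real.exp (-D) * Real.exp (-D * j) := by
        rw [← Real.exp_add]
        ring_nf
    _ ≤ Real.exp (-D) * Real.exp (-1) ^ j := by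
        rw [← Real.exp_nat_mul]
        refine mul_le_mul_of_nonneg_left (Real.exp_le_exp.2 ?_) (Real.exp_pos _).le
        nlinarith [(Nat.cast_nonneg j : (0 : ℝ) ≤ j)]
    _ ≤ _ := by gcongr

/-- The entropy bound at radius `ε = ℓ⁻² 16⁻ʲ` in exponential form, with `ρ = e^ℓ`. -/
lemma entropy_le_exp {ℓ c₄ c₅ c₆ : ℝ} (hℓ : 1 < ℓ) (hc₄ : 0 < c₄) (hc₆ : 0 < c₆) (j : ℕ) :
    c₄ * Real.exp ℓ * ℓ ^ c₅ * (1 / (ℓ ^ 2 * 16 ^ j)⁻¹) ^ c₆ ≤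
      c₄ * Real.exp (ℓ + (c₅ + 2 * c₆) * Real.log ℓ + 3 * c₆ * j) := by
  have hℓ0 : 0 < ℓ := by linarith
  have hlog16 : Real.log 16 ≤ 3 := by
    rw [show (16 : ℝ) = 2 ^ 4 by norm_num, Real.log_pow]
    have := Real.log_two_lt_d9
    push_cast
    linarith
  rw [one_div, inv_inv, Real.rpow_def_of_pos hℓ0, Real.rpow_def_of_pos (by positivity),
    Real.log_mul (by positivity) (by positivity), Real.log_pow, Real.log_pow, mul_assoc, mul_assoc,
    ← Real.exp_add, ← Real.exp_add]
  refine mul_le_mul_of_nonneg_left (Real.exp_le_exp.2 ?_) hc₄.le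
  have h1 : j * Real.log 16 * c₆ ≤ j * 3 * c₆ := by gcongr
  push_cast
  linarith

/-- The size of the net of one level times the tail probability of an increment of that level. -/
lemma entropy_mul_increment_tail_le {ℓ lam c₄ c₅ c₆ D : ℝ} (hℓ : 1 ≤ ℓ) (hlam : lam ≤ ℓ)
    (hc₄ : 0 < c₄) (hc₅ : 0 < c₅) (hc₆ : 0 < c₆) (hD : 1 ≤ D) (j : ℕ) :
    c₄ * Real.exp (ℓ + (c₅ + 2 * c₆) * lam + 3 * c₆ * (j + 1 : ℕ)) *
      (2 * Real.exp (-((1 + c₅ + 5 * c₆ + D) * ℓ * 4 ^ j))) ≤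
    2 * c₄ * Real.exp (-D) * (1 / 2) ^ j := by
  have hℓ0 : 0 ≤ ℓ := by linarith
  have h4j : (j : ℝ) + 1 ≤ 4 ^ j := by
    have := one_add_mul_le_pow (show (-2 : ℝ) ≤ 3 by norm_num) j
    norm_num at this
    linarith [(Nat.cast_nonneg j : (0 : ℝ) ≤ j)]
  have h4j1 : (1 : ℝ) ≤ 4 ^ j := one_le_pow₀ (by norm_num)
  have h1 : ℓ ≤ ℓ * 4 ^ j := le_mul_of_one_le_right hℓ0 h4j1
  have h2 : (c₅ + 2 * c₆) * lam ≤ (c₅ + 2 * c₆) * (ℓ * 4 ^ j) :=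
    mul_le_mul_of_nonneg_left (hlam.trans h1) (by positivity)
  have h3 : (j : ℝ) + 1 ≤ ℓ * 4 ^ j :=
    h4j.trans (le_mul_of_one_le_left (by positivity) hℓ)
  have h5 : 3 * c₆ * ((j : ℝ) + 1) ≤ 3 * c₆ * (ℓ * 4 ^ j) :=
    mul_le_mul_of_nonneg_left h3 (by positivity)
  have h6 : D * ((j : ℝ) + 1) ≤ D * (ℓ * 4 ^ j) := mul_le_mul_of_nonneg_left h3 (by linarith)
  have h7 : Real.exp (ℓ + (c₅ + 2 * c₆) * lam + 3 * c₆ * (j + 1 : ℕ)) *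
      Real.exp (-((1 + c₅ + 5 * c₆ + D) * ℓ * 4 ^ j)) ≤ Real.exp (-D * (j + 1)) := by
    rw [← Real.exp_add, Real.exp_le_exp]
    push_cast
    linarith
  have h8 := mul_le_mul_of_nonneg_left (h7.trans (exp_neg_mul_succ_le hD j))
    (show 0 ≤ 2 * c₄ by positivity)
  linarith

/-- Chaining down to the scale `ε_J = ℓ⁻² 16⁻ᴶ`. The coarsest net has at most `ρ` members up to a
power of `ℓ`, which gives the leading term; the increments along the chain add only `O(ℓ^{-1/2})`.
-/
lemma exists_net_nullPi_lt_abs_crossSum_le {c₄ c₅ c₆ δ : ℝ} (hc₄ : 0 < c₄) (hc₅ : 0 < c₅)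
    (hc₆ : 0 < c₆) (hδ : 0 < δ) :
    ∃ K > 0, ∃ M > 0, ∃ a₀ : ℝ, ∀ {ι : Type*} [Fintype ι] [DecidableEq ι]
      (𝓡 : Finset (Finset ι)) (a ℓ : ℝ), a₀ ≤ a → 1 < ℓ → 1 / 4 ≤ Real.log ℓ → ℓ ≤ a →
      (∀ ε : ℝ, 0 < ε → ε < 1 → (coveringNumber 𝓡 (a ^ 16) ε : ℝ) ≤
        c₄ * Real.exp ℓ * ℓ ^ c₅ * (1 / ε) ^ c₆) →
      ∀ J : ℕ, (16 : ℝ) ^ J ≤ a ^ 4 →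
      ∃ T ⊆ regionsOfSize 𝓡 (a ^ 16),
        (∀ R ∈ regionsOfSize 𝓡 (a ^ 16), ∃ R' ∈ T, regionDist R R' ≤ 4 * (ℓ ^ 2 * 16 ^ J)⁻¹) ∧
        nullPi ι {ω | ∃ R ∈ T,
          Real.sqrt (2 * ℓ + M * Real.log ℓ) + K / Real.sqrt ℓ < |crossSum R ω|} ≤
            ENNReal.ofReal (δ / 2) := by
  -- `D` makes the increments negligible, `M` the coarsest net
  obtain ⟨D, hD1, hD⟩ : ∃ D : ℝ, 1 ≤ D ∧ 2 * c₄ * Real.exp (-D) ≤ δ / 8 := by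
    have h1 : Tendsto (fun D : ℝ => 2 * c₄ * Real.exp (-D)) atTop (nhds (2 * c₄ * 0)) :=
      (Real.tendsto_exp_neg_atTop_nhds_zero).const_mul _
    rw [mul_zero] at h1
    obtain ⟨D, h2, h3⟩ := ((h1.eventually (ge_mem_nhds (show 0 < δ / 8 by positivity))).and
      (eventually_ge_atTop 1)).exists
    exact ⟨D, h3, h2⟩
  obtain ⟨E, hE0, hE⟩ : ∃ E : ℝ, 0 ≤ E ∧ 2 * c₄ * Real.exp (1 - E / 4) ≤ δ / 4 := by
    have h1 : Tendsto (fun E : ℝ => 1 - E / 4) atTop atBot := by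
      have := (tendsto_id.atTop_div_const (show (0 : ℝ) < 4 by norm_num))
      exact tendsto_atBot_add_const_left _ 1 (tendsto_neg_atTop_atBot.comp this)
    have h2 : Tendsto (fun E : ℝ => 2 * c₄ * Real.exp (1 - E / 4)) atTop (nhds (2 * c₄ * 0)) :=
      (Real.tendsto_exp_atBot.comp h1).const_mul _
    rw [mul_zero] at h2
    obtain ⟨E, h3, h4⟩ := ((h2.eventually (ge_mem_nhds (show 0 < δ / 4 by positivity))).and
      (eventually_ge_atTop 0)).exists
    exact ⟨E, h4, h3⟩
  set C : ℝ := 1 + c₅ + 5 * c₆ + D with hC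
  set M : ℝ := 2 * (c₅ + 2 * c₆ + E) with hM
  have hM0 : 0 < M := by positivity
  set k : ℝ := Real.sqrt (32 * C) with hk
  have hC0 : 0 < C := by positivity
  have hk2 : k ^ 2 = 32 * C := Real.sq_sqrt (by positivity)
  have hk0 : 0 < k := Real.sqrt_pos.2 (by positivity)
  refine ⟨2 * k, by positivity, M, hM0, max (max 2 C) (2 + M), ?_⟩
  intro ι _ _ 𝓡 a ℓ ha hℓ hlog hℓa hent J hJ
  have ha2 : 2 ≤ a := (le_max_left _ _).trans ((le_max_left _ _).trans ha)
  have haC : C ≤ a := (le_max_right _ _).trans ((le_max_left _ _).trans ha)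
  have haM : 2 + M ≤ a := (le_max_right _ _).trans ha
  have ha0 : 0 < a := by linarith
  have hℓ0 : 0 < ℓ := by linarith
  have hlogle : Real.log ℓ ≤ ℓ := Real.log_le_self hℓ0.le
  set lam := Real.log ℓ with hlam
  have hε0 : ∀ j : ℕ, 0 < (ℓ ^ 2 * 16 ^ j)⁻¹ := fun j => by positivity
  have hε1 : ∀ j : ℕ, (ℓ ^ 2 * 16 ^ j)⁻¹ < 1 := by
    intro j
    refine inv_lt_one_of_one_lt₀ ?_
    have h1 : 1 < ℓ ^ 2 := one_lt_pow₀ hℓ (by norm_num)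
    have h2 : (1 : ℝ) ≤ 16 ^ j := one_le_pow₀ (by norm_num)
    nlinarith
  choose T hTR hTcard hTnet using fun j : ℕ =>
    exists_internal_net (𝓡 := 𝓡) (A := a ^ 16) (by positivity) (hε0 j) (hε1 j)
  have hcard : ∀ j : ℕ, ((T j).card : ℝ) ≤
      c₄ * Real.exp (ℓ + (c₅ + 2 * c₆) * lam + 3 * c₆ * j) := fun j =>
    (Nat.cast_le.2 (hTcard j)).trans
      ((hent _ (hε0 j) (hε1 j)).trans (entropy_le_exp hℓ hc₄ hc₆ j))
  have hsize : ∀ {j : ℕ} {R : Finset ι}, R ∈ T j → a ^ 16 / 2 < R.card := fun hR =>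
    (mem_regionsOfSize.1 (hTR _ hR)).2.1
  refine ⟨T J, hTR J, hTnet J, ?_⟩
  -- the coarsest net
  set w := Real.sqrt (2 * ℓ + M * lam) with hw
  have hw2 : w ^ 2 = 2 * ℓ + M * lam := Real.sq_sqrt (by positivity)
  have hw2a : w ^ 2 ≤ a ^ 2 := by
    calc w ^ 2 ≤ (2 + M) * ℓ := by rw [hw2]; nlinarith
      _ ≤ a * a := by gcongr
      _ = a ^ 2 := by ring
  have hbase : nullPi ι {ω | ∃ R ∈ T 0, w < |crossSum R ω|} ≤ ENNReal.ofReal (δ / 4) := by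
    refine (measure_exists_mem_le fun R hR => nullPi_lt_abs_crossSum_le (A := a ^ 16)
      (by positivity) (hsize hR) (Real.sqrt_nonneg _) ?_ ?_).trans (ENNReal.ofReal_le_ofReal ?_)
    · calc w ^ 4 = (w ^ 2) ^ 2 := by ring
        _ ≤ (a ^ 2) ^ 2 := by gcongr
        _ = a ^ 4 := by ring
        _ ≤ a ^ 16 := pow_le_pow_right₀ (by linarith) (by norm_num)
    · have h4 : 2 ^ 2 ≤ a ^ 2 := by gcongr
      calc 4 * w ^ 2 ≤ a ^ 2 * a ^ 2 := by gcongr; linarith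
        _ = a ^ 4 := by ring
        _ ≤ a ^ 16 := pow_le_pow_right₀ (by linarith) (by norm_num)
    · calc ((T 0).card : ℝ) * (2 * Real.exp (1 - w ^ 2 / 2))
          ≤ c₄ * Real.exp (ℓ + (c₅ + 2 * c₆) * lam + 3 * c₆ * (0 : ℕ)) *
            (2 * Real.exp (1 - w ^ 2 / 2)) := by gcongr; exact hcard 0
        _ = 2 * c₄ * Real.exp (1 - E * lam) := by
          rw [show c₄ * Real.exp (ℓ + (c₅ + 2 * c₆) * lam + 3 * c₆ * (0 : ℕ)) *
            (2 * Real.exp (1 - w ^ 2 / 2)) =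
            2 * c₄ * (Real.exp (ℓ + (c₅ + 2 * c₆) * lam + 3 * c₆ * (0 : ℕ)) *
              Real.exp (1 - w ^ 2 / 2)) by ring, ← Real.exp_add, hw2, hM]
          congr 2
          push_cast
          ring
        _ ≤ 2 * c₄ * Real.exp (1 - E / 4) := by
          gcongr
          nlinarith
        _ ≤ δ / 4 := hE
  -- the increments
  set s := Real.sqrt ℓ with hs
  have hs0 : 0 < s := Real.sqrt_pos.2 hℓ0
  have hs2 : s ^ 2 = ℓ := Real.sq_sqrt hℓ0.le
  have hpow : ∀ j : ℕ, ((1 / 2 : ℝ) ^ j) ^ 2 = 1 / 4 ^ j := fun j => by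
    rw [← pow_mul, mul_comm, pow_mul, ← one_div_pow]
    norm_num
  have hchain := measure_exists_lt_abs_le_of_nets (μ := nullPi ι) (W := crossSum) (T := T)
    (t := fun j => k / s * (1 / 2) ^ j) (p := fun j => δ / 8 * (1 / 2) ^ j)
    (q := fun j => 2 * Real.exp (-(C * ℓ * 4 ^ j))) (fun j => by positivity)
    (by positivity) hbase J ?_ ?_
  · refine le_trans (measure_mono ?_) (hchain.trans (ENNReal.ofReal_le_ofReal ?_))
    · rintro ω ⟨R, hR, hω⟩
      refine ⟨R, hR, lt_of_le_of_lt ?_ hω⟩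
      rw [← Finset.mul_sum]
      have := sum_geometric_two_le J
      have h1 : k / s * ∑ j ∈ Finset.range J, (1 / 2 : ℝ) ^ j ≤ k / s * 2 := by gcongr
      have h2 : k / s * 2 = 2 * k / s := by ring
      linarith
    · rw [← Finset.mul_sum]
      have h1 : δ / 8 * ∑ j ∈ Finset.range J, (1 / 2 : ℝ) ^ j ≤ δ / 8 * 2 := by
        gcongr
        exact sum_geometric_two_le J
      linarith
  · intro j hj R hR
    obtain ⟨R', hR', hd⟩ := hTnet j R (hTR _ hR)
    refine ⟨R', hR', ?_⟩
    have hv : (0 : ℝ) < 8 * (ℓ ^ 2 * 16 ^ j)⁻¹ := by positivity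
    have ht2 : (k / s * (1 / 2) ^ j) ^ 2 = 32 * C / (ℓ * 4 ^ j) := by
      rw [mul_pow, div_pow, hk2, hs2, hpow]
      field_simp
    have h16 : (16 : ℝ) ^ j = 4 ^ j * 4 ^ j := by rw [← mul_pow]; norm_num
    refine (nullPi_lt_abs_crossSum_sub_le (A := a ^ 16) (by positivity) (hsize hR) (hsize hR') hv
      (by linarith) (by positivity) ?_).trans (ENNReal.ofReal_le_ofReal (le_of_eq ?_))
    · -- `C ℓ³ 64ʲ ≤ a ^ 16`, because `16ʲ ≤ a⁴`
      rw [ht2, div_le_iff₀ (by positivity)]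
      have h5 : (4 : ℝ) ^ j ≤ a ^ 4 := (pow_le_pow_left₀ (by norm_num) (by norm_num) j).trans
        ((pow_le_pow_right₀ (by norm_num) hj.le).trans hJ)
      have h6 : (16 : ℝ) ^ j ≤ a ^ 4 := (pow_le_pow_right₀ (by norm_num) hj.le).trans hJ
      have h7 : (8 * (ℓ ^ 2 * 16 ^ j)⁻¹) ^ 2 * a ^ 16 * (ℓ * 4 ^ j) =
          64 * a ^ 16 / (ℓ ^ 3 * (4 ^ j * 16 ^ j)) := by
        rw [h16]
        field_simp
        norm_num
      rw [h7, le_div_iff₀ (by positivity)]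
      calc 32 * C * (ℓ ^ 3 * (4 ^ j * 16 ^ j)) ≤ 32 * a * (a ^ 3 * (a ^ 4 * a ^ 4)) := by gcongr
        _ = 32 * a ^ 12 := by ring
        _ ≤ 64 * a ^ 16 := by
          have : a ^ 12 ≤ a ^ 16 := pow_le_pow_right₀ (by linarith) (by norm_num)
          nlinarith [pow_pos ha0 16]
    · rw [neg_div, ht2]
      congr 3
      rw [h16]
      field_simp
      ring
  · intro j hj
    calc ((T (j + 1)).card : ℝ) * (2 * Real.exp (-(C * ℓ * 4 ^ j)))
        ≤ c₄ * Real.exp (ℓ + (c₅ + 2 * c₆) * lam + 3 * c₆ * (j + 1 : ℕ)) *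
          (2 * Real.exp (-(C * ℓ * 4 ^ j))) := by gcongr; exact hcard (j + 1)
      _ ≤ 2 * c₄ * Real.exp (-D) * (1 / 2) ^ j :=
        entropy_mul_increment_tail_le hℓ.le hlogle hc₄ hc₅ hc₆ hD1 j
      _ ≤ δ / 8 * (1 / 2) ^ j := by gcongr

/-- The union bound over all regions of size about `A = a ^ 16` is harmless against tails of the
order `e^{-a²/4}`, even though their number involves `n = e^ℓ A` and not only `n / A`. -/
lemma exists_forall_count_mul_exp_le (c₁ c₂ : ℝ) {η : ℝ} (hη : 0 < η) :
    ∃ a₀ : ℝ, ∀ a : ℝ, a₀ ≤ a →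
      c₁ * (Real.exp a * a ^ 16) * (a ^ 16) ^ c₂ * (6 * Real.exp (-a ^ 2 / 4)) ≤ η := by
  have h1 := ((tendsto_rpow_mul_exp_neg_mul_atTop_nhds_zero (16 + 16 * c₂) 1 one_pos).const_mul
    (6 * |c₁|))
  rw [mul_zero] at h1
  obtain ⟨a₀, ha₀⟩ := eventually_atTop.1 (h1.eventually (ge_mem_nhds hη))
  refine ⟨max a₀ 8, fun a ha => le_trans ?_ (ha₀ a ((le_max_left _ _).trans ha))⟩
  have ha8 : 8 ≤ a := (le_max_right _ _).trans ha
  have ha0 : 0 < a := by linarith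
  have hpow : a ^ (16 + 16 * c₂) = a ^ 16 * (a ^ 16) ^ c₂ := by
    rw [Real.rpow_add ha0, Real.rpow_mul ha0.le]
    norm_cast
  have hexp : Real.exp a * Real.exp (-a ^ 2 / 4) ≤ Real.exp (-1 * a) := by
    rw [← Real.exp_add, Real.exp_le_exp]
    nlinarith
  calc c₁ * (Real.exp a * a ^ 16) * (a ^ 16) ^ c₂ * (6 * Real.exp (-a ^ 2 / 4))
      = c₁ * (6 * (a ^ 16 * (a ^ 16) ^ c₂) * (Real.exp a * Real.exp (-a ^ 2 / 4))) := by ring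
    _ ≤ |c₁| * (6 * (a ^ 16 * (a ^ 16) ^ c₂) * (Real.exp a * Real.exp (-a ^ 2 / 4))) := by
        gcongr
        exact le_abs_self c₁
    _ ≤ |c₁| * (6 * (a ^ 16 * (a ^ 16) ^ c₂) * Real.exp (-1 * a)) := by gcongr
    _ = _ := by
        rw [hpow]
        ring

/-- The increments below the finest scale of the chain are negligible with overwhelming
probability. -/
lemma nullPi_lt_abs_crossSum_sub_le_of_finest {ι : Type*} [Fintype ι] [DecidableEq ι]
    {R R' : Finset ι} {a ℓ : ℝ} {J : ℕ} (ha : 128 ≤ a) (hℓ : 1 ≤ ℓ) (hℓa : ℓ ≤ a)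
    (hR : a ^ 16 / 2 < R.card) (hR' : a ^ 16 / 2 < R'.card) (hJ : a ^ 4 < 16 ^ (J + 1))
    (hd : regionDist R R' ≤ 4 * (ℓ ^ 2 * 16 ^ J)⁻¹) :
    nullPi ι {ω | 1 / Real.sqrt ℓ < |crossSum R ω - crossSum R' ω|} ≤
      ENNReal.ofReal (2 * Real.exp (-a ^ 2 / 4)) := by
  have ha0 : 0 < a := by linarith
  have hℓ0 : 0 < ℓ := by linarith
  have hv : (0 : ℝ) < 128 / a ^ 4 := by positivity
  have hts : (1 / Real.sqrt ℓ) ^ 2 = 1 / ℓ := by rw [div_pow, one_pow, Real.sq_sqrt hℓ0.le]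
  refine (nullPi_lt_abs_crossSum_sub_le (A := a ^ 16) (by positivity) hR hR' hv ?_
    (by positivity) ?_).trans (ENNReal.ofReal_le_ofReal ?_)
  · have h1 : (ℓ ^ 2 * 16 ^ J)⁻¹ ≤ (a ^ 4 / 16)⁻¹ := by
      refine inv_anti₀ (by positivity) ?_
      have h2 : (16 : ℝ) ^ J ≤ ℓ ^ 2 * 16 ^ J :=
        le_mul_of_one_le_left (by positivity) (one_le_pow₀ hℓ)
      have h4 : (16 : ℝ) ^ (J + 1) = 16 ^ J * 16 := pow_succ _ _
      linarith
    have h3 : (128 : ℝ) / a ^ 4 = 8 * (a ^ 4 / 16)⁻¹ := by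
      field_simp
      norm_num
    linarith
  · rw [hts]
    have h1 : 1 / ℓ ≤ 1 := (div_le_one hℓ0).2 hℓ
    have h2 : (128 / a ^ 4) ^ 2 * a ^ 16 = 16384 * a ^ 8 := by
      field_simp
      norm_num
    have h3 : 1 ≤ a ^ 8 := one_le_pow₀ (by linarith)
    linarith
  · refine mul_le_mul_of_nonneg_left (Real.exp_le_exp.2 ?_) (by norm_num)
    rw [neg_div, hts]
    have h1 : -(1 / ℓ / (4 * (128 / a ^ 4))) = -(a ^ 4 / (512 * ℓ)) := by
      field_simp
      norm_num
    rw [h1, neg_div, neg_le_neg_iff, div_le_div_iff₀ (by norm_num) (by positivity)]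
    have h2 : a ^ 2 * (512 * ℓ) ≤ a ^ 2 * (512 * a) := by gcongr
    have h3 : a ^ 3 * 128 ≤ a ^ 3 * a := by gcongr
    linarith

/-- The square of the final bound for the sample covariance. -/
lemma sq_add_three_le {ℓ lam M K : ℝ} (hℓ : 1 ≤ ℓ) (hlam : lam ≤ ℓ) (hlam' : 1 / 4 ≤ lam)
    (hM : 0 ≤ M) (hK : 0 ≤ K) :
    (Real.sqrt (2 * ℓ + M * lam) + K / Real.sqrt ℓ + 1 / Real.sqrt ℓ) ^ 2 + 3 ≤
      2 * ℓ + (M + 4 * (2 * (K + 1) * Real.sqrt (2 + M) + (K + 1) ^ 2 + 3)) * lam := by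
  have hℓ0 : 0 < ℓ := by linarith
  set C : ℝ := 2 * (K + 1) * Real.sqrt (2 + M) + (K + 1) ^ 2 + 3 with hC
  have hC0 : 0 ≤ C := by positivity
  set s := Real.sqrt ℓ with hs
  have hs0 : 0 < s := Real.sqrt_pos.2 hℓ0
  have hs2 : s ^ 2 = ℓ := Real.sq_sqrt hℓ0.le
  set w := Real.sqrt (2 * ℓ + M * lam) with hw
  have hw2 : w ^ 2 = 2 * ℓ + M * lam := Real.sq_sqrt (by positivity)
  have hws : w ≤ Real.sqrt (2 + M) * s := by
    rw [hw, hs, ← Real.sqrt_mul (by positivity)]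
    exact Real.sqrt_le_sqrt (by nlinarith)
  have h1 : (w + K / s + 1 / s) ^ 2 = w ^ 2 + 2 * (K + 1) * (w / s) + (K + 1) ^ 2 / s ^ 2 := by
    field_simp
    ring
  have h2 : w / s ≤ Real.sqrt (2 + M) := by rwa [div_le_iff₀ hs0]
  have h3 : (K + 1) ^ 2 / s ^ 2 ≤ (K + 1) ^ 2 :=
    div_le_self (by positivity) (by rw [hs2]; exact hℓ)
  have h4 : 2 * (K + 1) * (w / s) ≤ 2 * (K + 1) * Real.sqrt (2 + M) := by gcongr
  have h5 : C ≤ 4 * C * lam := by nlinarith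
  rw [h1, hw2]
  linarith

/-- The upper bound when `A = a ^ 16` is at least a power of `ℓ = log (n / A)`. -/
lemma exists_nullPi_lt_logLR_le_of_log_le {c₁ c₂ c₄ c₅ c₆ δ : ℝ} (hc₁ : 0 < c₁) (hc₄ : 0 < c₄)
    (hc₅ : 0 < c₅) (hc₆ : 0 < c₆) (hδ : 0 < δ) :
    ∃ M > 0, ∃ a₀ : ℝ, ∀ {ι : Type*} [Fintype ι] [DecidableEq ι]
      (𝓡 : Finset (Finset ι)) (a ℓ : ℝ), a₀ ≤ a → 1 < ℓ → 1 / 4 ≤ Real.log ℓ → ℓ ≤ a →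
      ((regionsOfSize 𝓡 (a ^ 16)).card : ℝ) ≤ c₁ * (Real.exp ℓ * a ^ 16) * (a ^ 16) ^ c₂ →
      (∀ ε : ℝ, 0 < ε → ε < 1 → (coveringNumber 𝓡 (a ^ 16) ε : ℝ) ≤
        c₄ * Real.exp ℓ * ℓ ^ c₅ * (1 / ε) ^ c₆) →
      nullPi ι {ω | ∃ R ∈ regionsOfSize 𝓡 (a ^ 16), 2 * ℓ + M * Real.log ℓ <
        logLR R (fun i => (ω i).1) fun i => (ω i).2} ≤ ENNReal.ofReal δ := by
  obtain ⟨K, hK, M₀, hM₀, a₁, hchain⟩ := exists_net_nullPi_lt_abs_crossSum_le hc₄ hc₅ hc₆ hδ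
  obtain ⟨a₂, hcount⟩ := exists_forall_count_mul_exp_le c₁ c₂ (show 0 < δ / 4 by positivity)
  set C : ℝ := 2 * (K + 1) * Real.sqrt (2 + M₀) + (K + 1) ^ 2 + 3 with hC
  have hC0 : 0 < C := by positivity
  refine ⟨M₀ + 4 * C, by positivity, max (max a₁ a₂) (max 128 (2 + (M₀ + 4 * C))), ?_⟩
  intro ι _ _ 𝓡 a ℓ ha hℓ hlog hℓa hcard hent
  have ha1 : a₁ ≤ a := (le_max_left _ _).trans ((le_max_left _ _).trans ha)
  have ha2 : a₂ ≤ a := (le_max_right _ _).trans ((le_max_left _ _).trans ha)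
  have ha3 : 128 ≤ a := (le_max_left _ _).trans ((le_max_right _ _).trans ha)
  have ha4 : 2 + (M₀ + 4 * C) ≤ a := (le_max_right _ _).trans ((le_max_right _ _).trans ha)
  have ha0 : 0 < a := by linarith
  have hℓ0 : 0 < ℓ := by linarith
  have hlogle : Real.log ℓ ≤ ℓ := Real.log_le_self hℓ0.le
  set lam := Real.log ℓ with hlam
  obtain ⟨J, hJ, hJ'⟩ := exists_nat_pow_near (show (1 : ℝ) ≤ a ^ 4 from one_le_pow₀ (by linarith))
    (show (1 : ℝ) < 16 by norm_num)
  obtain ⟨T, hTR, hTnet, hT⟩ := hchain 𝓡 a ℓ ha1 hℓ hlog hℓa hent J hJ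
  set s := Real.sqrt ℓ with hs
  have hs0 : 0 < s := Real.sqrt_pos.2 hℓ0
  set w₀ := Real.sqrt (2 * ℓ + M₀ * lam) with hw₀
  have hw₀0 : 0 ≤ w₀ := Real.sqrt_nonneg _
  set w := w₀ + K / s + 1 / s with hw
  have hw0 : 0 ≤ w := by positivity
  -- the final bound for the sample covariance, squared
  have hw2 : w ^ 2 + 3 ≤ 2 * ℓ + (M₀ + 4 * C) * lam :=
    sq_add_three_le hℓ.le hlogle hlog hM₀.le hK.le
  have hwa : 4 * (w ^ 2 + 2) ≤ a ^ 4 := by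
    have h1 : 2 * ℓ + (M₀ + 4 * C) * lam ≤ (2 + (M₀ + 4 * C)) * ℓ := by
      have : (M₀ + 4 * C) * lam ≤ (M₀ + 4 * C) * ℓ := by gcongr
      linarith
    have h2 : (2 + (M₀ + 4 * C)) * ℓ ≤ a * a := by gcongr
    have h3 : 4 * (a * a) ≤ a * a * (a * a) := by gcongr; nlinarith
    have h4 : a ^ 4 = a * a * (a * a) := by ring
    linarith
  -- the last step of the chain, from the finest net to all regions
  have hq : (0 : ℝ) ≤ 2 * Real.exp (-a ^ 2 / 4) := by positivity
  have hlast := measure_exists_lt_abs_le_of_net (μ := nullPi ι) (W := crossSum)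
    (S := regionsOfSize 𝓡 (a ^ 16)) (t := 1 / s) hq (by positivity) hT (fun R hR => by
      obtain ⟨R', hR', hd⟩ := hTnet R hR
      exact ⟨R', hR', nullPi_lt_abs_crossSum_sub_le_of_finest ha3 hℓ.le hℓa
        (mem_regionsOfSize.1 hR).2.1 (mem_regionsOfSize.1 (hTR hR')).2.1 hJ' hd⟩)
  have hcard' : ((regionsOfSize 𝓡 (a ^ 16)).card : ℝ) * (6 * Real.exp (-a ^ 2 / 4)) ≤ δ / 4 := by
    refine le_trans ?_ (hcount a ha2)
    refine mul_le_mul_of_nonneg_right (hcard.trans ?_) (by positivity)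
    gcongr
  have hmom := nullPi_exists_moments_le 𝓡 (show 1 ≤ a by linarith)
  have hsub : {ω | ∃ R ∈ regionsOfSize 𝓡 (a ^ 16), 2 * ℓ + (M₀ + 4 * C) * lam <
        logLR R (fun i => (ω i).1) fun i => (ω i).2} ⊆
      {ω | ∃ R ∈ regionsOfSize 𝓡 (a ^ 16), w < |crossSum R ω|} ∪
      {ω : ι → ℝ × ℝ | ∃ R ∈ regionsOfSize 𝓡 (a ^ 16),
        a ^ 9 < |∑ i ∈ R, (ω i).1| ∨ a ^ 9 < |∑ i ∈ R, (ω i).2| ∨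
        ∑ i ∈ R, (ω i).1 ^ 2 < R.card - a ^ 9 ∨ ∑ i ∈ R, (ω i).2 ^ 2 < R.card - a ^ 9} := by
    rintro ω ⟨R, hR, hω⟩
    by_contra hcon
    simp only [Set.mem_union, Set.mem_ofPred_eq] at hcon
    rw [not_or] at hcon
    have h1 : |crossSum R ω| ≤ w := by
      by_contra! h
      exact hcon.1 ⟨R, hR, h⟩
    have h2 := logLR_le_of_moments (by linarith) hw0 (mem_regionsOfSize.1 hR).2.1 h1 hwa
      fun h => hcon.2 ⟨R, hR, h⟩
    linarith
  refine (measure_mono hsub).trans ((measure_union_le _ _).trans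
    ((add_le_add hlast hmom).trans ?_))
  rw [← ENNReal.ofReal_add (by positivity) (by positivity)]
  refine ENNReal.ofReal_le_ofReal ?_
  linarith

/-! ### The upper bound for small regions, and for all regions -/

/-- The upper bound when `A` is at most a power of `ℓ = log (n / A)`: the union bound over all of
`𝓡(A)` costs only a power of `ℓ`. -/
lemma exists_nullPi_lt_logLR_le_of_le_log {c₁ c₂ δ : ℝ} (hc₁ : 0 < c₁) (hc₂ : 0 < c₂)
    (hδ : 0 < δ) :
    ∃ M > 0, ∀ {ι : Type*} [Fintype ι] (𝓡 : Finset (Finset ι)) (A ℓ : ℝ), 0 < A → 1 < ℓ →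
      1 / 4 ≤ Real.log ℓ → A ≤ ℓ ^ 16 → (∀ R ∈ regionsOfSize 𝓡 A, 3 ≤ R.card) →
      ((regionsOfSize 𝓡 A).card : ℝ) ≤ c₁ * (Real.exp ℓ * A) * A ^ c₂ →
      nullPi ι {ω | ∃ R ∈ regionsOfSize 𝓡 A, 2 * ℓ + M * Real.log ℓ <
        logLR R (fun i => (ω i).1) fun i => (ω i).2} ≤ ENNReal.ofReal δ := by
  obtain ⟨E, hE0, hE⟩ : ∃ E : ℝ, 0 ≤ E ∧ 2 * c₁ * Real.exp (-(E / 4)) ≤ δ := by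
    have h1 : Tendsto (fun E : ℝ => E / 4) atTop atTop :=
      tendsto_id.atTop_div_const (show (0 : ℝ) < 4 by norm_num)
    have h2 : Tendsto (fun E : ℝ => 2 * c₁ * Real.exp (-(E / 4))) atTop (nhds (2 * c₁ * 0)) :=
      (Real.tendsto_exp_neg_atTop_nhds_zero.comp h1).const_mul _
    rw [mul_zero] at h2
    obtain ⟨E, h3, h4⟩ := ((h2.eventually (ge_mem_nhds hδ)).and (eventually_ge_atTop 0)).exists
    exact ⟨E, h4, h3⟩
  refine ⟨2 * (16 + 16 * c₂ + E), by positivity, ?_⟩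
  intro ι _ 𝓡 A ℓ hA hℓ hlog hAℓ hsize hcard
  have hℓ0 : 0 < ℓ := by linarith
  set lam := Real.log ℓ with hlam
  have hexplam : Real.exp lam = ℓ := Real.exp_log hℓ0
  refine (measure_exists_mem_le fun R hR => nullPi_lt_logLR_le (hsize R hR)
    (by positivity)).trans (ENNReal.ofReal_le_ofReal ?_)
  have hAexp : A ≤ Real.exp (16 * lam) := by
    rw [show (16 : ℝ) * lam = (16 : ℕ) * lam by norm_num, Real.exp_nat_mul, hexplam]
    exact hAℓ
  have hAc : A ^ c₂ ≤ Real.exp (16 * lam * c₂) := by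
    rw [Real.exp_mul]
    gcongr
  calc ((regionsOfSize 𝓡 A).card : ℝ) *
        (2 * Real.exp (-(2 * ℓ + 2 * (16 + 16 * c₂ + E) * lam) / 2))
      ≤ c₁ * (Real.exp ℓ * Real.exp (16 * lam)) * Real.exp (16 * lam * c₂) *
        (2 * Real.exp (-(2 * ℓ + 2 * (16 + 16 * c₂ + E) * lam) / 2)) := by
        gcongr
        exact hcard.trans (by gcongr)
    _ = 2 * c₁ * (Real.exp ℓ * Real.exp (16 * lam) * Real.exp (16 * lam * c₂) *
        Real.exp (-(2 * ℓ + 2 * (16 + 16 * c₂ + E) * lam) / 2)) := by ring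
    _ = 2 * c₁ * Real.exp (-(E * lam)) := by
        rw [← Real.exp_add, ← Real.exp_add, ← Real.exp_add]
        congr 2
        ring
    _ ≤ 2 * c₁ * Real.exp (-(E / 4)) := by
        gcongr
        nlinarith
    _ ≤ δ := hE

lemma one_lt_log_of_four_le {ρ : ℝ} (h : 4 ≤ ρ) : 1.38 < Real.log ρ := by
  have h1 : Real.log 4 ≤ Real.log ρ := Real.log_le_log (by norm_num) h
  have h2 : Real.log 4 = 2 * Real.log 2 := by
    rw [show (4 : ℝ) = 2 ^ 2 by norm_num, Real.log_pow]
    norm_num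
  have := Real.log_two_gt_d9
  norm_num at this ⊢
  linarith

lemma log_log_ge_of_four_le {ρ : ℝ} (h : 4 ≤ ρ) : 1 / 4 ≤ Real.log (Real.log ρ) := by
  have h1 := one_lt_log_of_four_le h
  have h2 := Real.one_sub_inv_le_log_of_pos (show 0 < Real.log ρ by linarith)
  have h3 : (Real.log ρ)⁻¹ ≤ 3 / 4 := by
    rw [inv_le_comm₀ (by linarith) (by norm_num)]
    norm_num at h1 ⊢
    linarith
  linarith

/-- The upper bound, uniformly over all libraries on index sets that are large enough. -/
theorem exists_nullPi_lt_logLR_le {c₁ c₂ c₄ c₅ c₆ δ : ℝ} (hc₁ : 0 < c₁) (hc₂ : 0 < c₂)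
    (hc₄ : 0 < c₄) (hc₅ : 0 < c₅) (hc₆ : 0 < c₆) (hδ : 0 < δ) :
    ∃ M > 0, ∃ n₀ : ℝ, ∀ {ι : Type*} [Fintype ι] [DecidableEq ι]
      (𝓡 : Finset (Finset ι)) (n A : ℝ), n₀ ≤ n → 0 < A → A ≤ n / 4 →
      (∀ R ∈ regionsOfSize 𝓡 A, 3 ≤ R.card) →
      ((regionsOfSize 𝓡 A).card : ℝ) ≤ c₁ * n * A ^ c₂ →
      (∀ ε : ℝ, 0 < ε → ε < 1 → (coveringNumber 𝓡 A ε : ℝ) ≤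
        c₄ * (n / A) * Real.log (n / A) ^ c₅ * (1 / ε) ^ c₆) →
      nullPi ι {ω | ∃ R ∈ regionsOfSize 𝓡 A,
        2 * Real.log (n / A) + M * Real.log (Real.log (n / A)) <
          logLR R (fun i => (ω i).1) fun i => (ω i).2} ≤ ENNReal.ofReal δ := by
  obtain ⟨M₁, hM₁, h₁⟩ := exists_nullPi_lt_logLR_le_of_le_log hc₁ hc₂ hδ
  obtain ⟨M₂, hM₂, a₀, h₂⟩ :=
    exists_nullPi_lt_logLR_le_of_log_le (c₂ := c₂) hc₁ hc₄ hc₅ hc₆ hδ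
  refine ⟨max M₁ M₂, lt_max_of_lt_left hM₁, Real.exp |a₀| * |a₀| ^ 16 + 1, ?_⟩
  intro ι _ _ 𝓡 n A hn hA hAn hsize hcard hent
  have hρ : 4 ≤ n / A := by
    rw [le_div_iff₀ hA]
    linarith
  have hℓ1 := one_lt_log_of_four_le hρ
  have hlog := log_log_ge_of_four_le hρ
  have hexp : Real.exp (Real.log (n / A)) = n / A := Real.exp_log (by linarith)
  set ℓ := Real.log (n / A) with hℓ
  have hℓ1' : 1 < ℓ := lt_trans (by norm_num) hℓ1
  have hnA : n = Real.exp ℓ * A := by rw [hexp, div_mul_cancel₀ _ hA.ne']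
  rw [hnA] at hcard
  rw [← hexp] at hent
  have hmono : ∀ M ≤ max M₁ M₂, {ω : ι → ℝ × ℝ | ∃ R ∈ regionsOfSize 𝓡 A,
      2 * ℓ + max M₁ M₂ * Real.log ℓ < logLR R (fun i => (ω i).1) fun i => (ω i).2} ⊆
      {ω | ∃ R ∈ regionsOfSize 𝓡 A,
      2 * ℓ + M * Real.log ℓ < logLR R (fun i => (ω i).1) fun i => (ω i).2} := by
    rintro M hM ω ⟨R, hR, hω⟩
    refine ⟨R, hR, lt_of_le_of_lt ?_ hω⟩
    gcongr
  rcases le_or_gt A (ℓ ^ 16) with hAℓ | hAℓ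
  · exact (measure_mono (hmono M₁ (le_max_left _ _))).trans
      (h₁ 𝓡 A ℓ hA hℓ1' hlog hAℓ hsize hcard)
  · refine (measure_mono (hmono M₂ (le_max_right _ _))).trans ?_
    set a : ℝ := A ^ (1 / 16 : ℝ) with ha
    have ha0 : 0 < a := Real.rpow_pos_of_pos hA _
    have ha16 : a ^ 16 = A := by
      rw [ha, ← Real.rpow_natCast, ← Real.rpow_mul hA.le]
      norm_num
    have hℓa : ℓ ≤ a := by
      rw [← ha16] at hAℓ
      exact (lt_of_pow_lt_pow_left₀ 16 ha0.le hAℓ).le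
    have haa : a₀ ≤ a := by
      by_contra! hlt
      have h3 : a ≤ |a₀| := hlt.le.trans (le_abs_self _)
      have h4 : n ≤ Real.exp |a₀| * |a₀| ^ 16 := by
        rw [hnA, ← ha16]
        gcongr
        exact hℓa.trans h3
      linarith
    rw [← ha16] at hcard hent ⊢
    exact h₂ 𝓡 a ℓ haa hℓ1' hlog hℓa hcard hent

/-! ### The lower bound -/

lemma logLR_congr {ι : Type*} {R : Finset ι} {x y x' y' : ι → ℝ} (hx : ∀ i ∈ R, x i = x' i)
    (hy : ∀ i ∈ R, y i = y' i) : logLR R x y = logLR R x' y' := by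
  rw [logLR_eq_univ, logLR_eq_univ R x' y']
  congr 1 <;> ext ⟨i, hi⟩
  · exact hx i hi
  · exact hy i hi

section

variable {ι : Type*} [Fintype ι]

/-- The statistics of pairwise disjoint regions are independent. -/
lemma nullPi_forall_logLR_le_eq_prod (S : Finset (Finset ι))
    (hS : (S : Set (Finset ι)).PairwiseDisjoint id) (t : ℝ) :
    nullPi ι {ω | ∀ R ∈ S, logLR R (fun i => (ω i).1) (fun i => (ω i).2) ≤ t} =
      ∏ R ∈ S, nullPi ι {ω | logLR R (fun i => (ω i).1) (fun i => (ω i).2) ≤ t} := by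
  classical
  induction S using Finset.cons_induction with
  | empty => simp
  | cons R S hR ih =>
    rw [Finset.prod_cons, ← ih (hS.subset (by simp))]
    set U : Finset ι := S.biUnion id with hU
    have hdisj : Disjoint R U := by
      rw [hU, Finset.disjoint_biUnion_right]
      intro R' hR'
      exact hS (by simp) (by simp [hR']) (fun h => hR (h ▸ hR'))
    have hind : IndepFun (fun (ω : ι → ℝ × ℝ) (i : R) => ω i) (fun ω (i : U) => ω i) (nullPi ι) :=
      (iIndepFun_pi (X := fun _ => id) fun _ => aemeasurable_id).indepFun_finset R U hdisj
        (fun i => measurable_pi_apply i)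
    -- the events as preimages under the restrictions, by extending a configuration by zero
    let ext (V : Finset ι) (η : V → ℝ × ℝ) (i : ι) : ℝ × ℝ := if h : i ∈ V then η ⟨i, h⟩ else 0
    have hext : ∀ V : Finset ι, Measurable (ext V) := fun V => by
      refine measurable_pi_lambda _ fun i => ?_
      by_cases h : i ∈ V <;> simp only [ext, h, dif_pos, dif_neg, not_false_eq_true] <;> fun_prop
    have hlog : ∀ {V R' : Finset ι}, R' ⊆ V → ∀ ω : ι → ℝ × ℝ,
        logLR R' (fun i => (ext V (fun i => ω i) i).1) (fun i => (ext V (fun i => ω i) i).2) =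
          logLR R' (fun i => (ω i).1) fun i => (ω i).2 := by
      intro V R' hV ω
      refine logLR_congr (fun i hi => ?_) (fun i hi => ?_) <;> simp [ext, hV hi]
    have hmeas : ∀ V R' : Finset ι, Measurable fun η : V → ℝ × ℝ =>
        logLR R' (fun i => (ext V η i).1) fun i => (ext V η i).2 := fun V R' => by
      have := hext V
      fun_prop
    have h1 := hind.measure_inter_preimage_eq_mul
      {η | logLR R (fun i => (ext R η i).1) (fun i => (ext R η i).2) ≤ t}
      {η | ∀ R' ∈ S, logLR R' (fun i => (ext U η i).1) (fun i => (ext U η i).2) ≤ t}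
      (measurableSet_le (hmeas R R) measurable_const) (by
        have : {η : U → ℝ × ℝ | ∀ R' ∈ S,
            logLR R' (fun i => (ext U η i).1) (fun i => (ext U η i).2) ≤ t} =
            ⋂ R' ∈ S, {η | logLR R' (fun i => (ext U η i).1) (fun i => (ext U η i).2) ≤ t} := by
          ext η
          simp
        rw [this]
        exact Finset.measurableSet_biInter _ fun R' _ =>
          measurableSet_le (hmeas U R') measurable_const)
    have hsub : ∀ R' ∈ S, R' ⊆ U := fun R' hR' => Finset.subset_biUnion_of_mem id hR'
    have e1 : (fun (ω : ι → ℝ × ℝ) (i : R) => ω i) ⁻¹'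
        {η | logLR R (fun i => (ext R η i).1) (fun i => (ext R η i).2) ≤ t} =
        {ω | logLR R (fun i => (ω i).1) (fun i => (ω i).2) ≤ t} := by
      ext ω
      simp only [Set.mem_preimage, Set.mem_ofPred_eq]
      rw [hlog (Finset.Subset.refl R)]
    have e2 : (fun (ω : ι → ℝ × ℝ) (i : U) => ω i) ⁻¹'
        {η | ∀ R' ∈ S, logLR R' (fun i => (ext U η i).1) (fun i => (ext U η i).2) ≤ t} =
        {ω | ∀ R' ∈ S, logLR R' (fun i => (ω i).1) (fun i => (ω i).2) ≤ t} := by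
      ext ω
      simp only [Set.mem_preimage, Set.mem_ofPred_eq]
      exact forall₂_congr fun R' hR' => by rw [hlog (hsub R' hR')]
    rw [e1, e2] at h1
    rw [← h1]
    congr 1
    ext ω
    simp

lemma nullPi_forall_logLR_le_le_exp {S : Finset (Finset ι)}
    (hS : (S : Set (Finset ι)).PairwiseDisjoint id) {t p : ℝ}
    (hp : ∀ R ∈ S, ENNReal.ofReal p ≤
      nullPi ι {ω | t < logLR R (fun i => (ω i).1) fun i => (ω i).2}) :
    nullPi ι {ω | ∀ R ∈ S, logLR R (fun i => (ω i).1) (fun i => (ω i).2) ≤ t} ≤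
      ENNReal.ofReal (Real.exp (-(S.card * p))) := by
  rw [nullPi_forall_logLR_le_eq_prod S hS]
  have h1 : ∀ R ∈ S, nullPi ι {ω | logLR R (fun i => (ω i).1) (fun i => (ω i).2) ≤ t} ≤
      ENNReal.ofReal (Real.exp (-p)) := by
    intro R hR
    have hm : MeasurableSet {ω : ι → ℝ × ℝ | t < logLR R (fun i => (ω i).1) fun i => (ω i).2} :=
      measurableSet_lt measurable_const (by fun_prop)
    have hc : {ω : ι → ℝ × ℝ | logLR R (fun i => (ω i).1) (fun i => (ω i).2) ≤ t} =
        {ω | t < logLR R (fun i => (ω i).1) fun i => (ω i).2}ᶜ := by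
      ext ω
      simp
    rw [hc, prob_compl_eq_one_sub hm]
    refine (tsub_le_tsub_left (hp R hR) 1).trans ?_
    rcases le_or_gt 0 p with h0 | h0
    · rw [← ENNReal.ofReal_one, ← ENNReal.ofReal_sub 1 h0]
      exact ENNReal.ofReal_le_ofReal (by linarith [Real.add_one_le_exp (-p)])
    · refine (tsub_le_self).trans ?_
      rw [ENNReal.one_le_ofReal, Real.one_le_exp_iff]
      linarith
  refine (Finset.prod_le_prod' h1).trans (le_of_eq ?_)
  rw [Finset.prod_const, ← ENNReal.ofReal_pow (Real.exp_pos _).le, ← Real.exp_nat_mul]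
  congr 2
  ring

end

lemma exists_packing {ι : Type*} (𝓡 : Finset (Finset ι)) (A : ℝ) :
    ∃ S ⊆ regionsOfSize 𝓡 A, (S : Set (Finset ι)).PairwiseDisjoint id ∧
      S.card = packingNumber 𝓡 A := by
  classical
  obtain ⟨S, hS, hcard⟩ := Finset.exists_mem_eq_sup
    ((regionsOfSize 𝓡 A).powerset.filter
      fun S : Finset (Finset ι) => (S : Set (Finset ι)).PairwiseDisjoint id)
    ⟨∅, by simp⟩ Finset.card
  rw [Finset.mem_filter, Finset.mem_powerset] at hS
  refine ⟨S, hS.1, hS.2, ?_⟩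
  rw [← hcard]
  unfold packingNumber
  congr!

/-- The lower bound: about `ρ = n / A` independent statistics with tails `e^{-t/2}` up to a power
of `t` exceed `2 log ρ - M log log ρ` with high probability. -/
theorem exists_nullPi_forall_logLR_le_le {c₃ δ : ℝ} (hc₃ : 0 < c₃) (hδ : 0 < δ) :
    ∃ M > 0, ∀ {ι : Type*} [Fintype ι] (𝓡 : Finset (Finset ι)) (n A : ℝ), 0 < A → A ≤ n / 4 →
      (∀ R ∈ regionsOfSize 𝓡 A, 3 ≤ R.card) → c₃ * (n / A) ≤ packingNumber 𝓡 A →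
      nullPi ι {ω | ∀ R ∈ regionsOfSize 𝓡 A, logLR R (fun i => (ω i).1) (fun i => (ω i).2) ≤
        2 * Real.log (n / A) - M * Real.log (Real.log (n / A))} ≤ ENNReal.ofReal δ := by
  have hc := gaussTailConst_pos
  set c : ℝ := c₃ * gaussTailConst * Real.exp (-1 / 2) / 2 with hcdef
  have hc0 : 0 < c := by positivity
  obtain ⟨E, hE0, hE⟩ : ∃ E : ℝ, 0 ≤ E ∧ Real.exp (-(c * Real.exp (E / 4))) ≤ δ := by
    have h1 : Tendsto (fun E : ℝ => c * Real.exp (E / 4)) atTop atTop :=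
      (Real.tendsto_exp_atTop.comp
        (tendsto_id.atTop_div_const (show (0 : ℝ) < 4 by norm_num))).const_mul_atTop hc0
    have h2 := Real.tendsto_exp_neg_atTop_nhds_zero.comp h1
    obtain ⟨E, h3, h4⟩ := ((h2.eventually (ge_mem_nhds hδ)).and (eventually_ge_atTop 0)).exists
    exact ⟨E, h4, h3⟩
  refine ⟨2 * (1 + E), by positivity, ?_⟩
  intro ι _ 𝓡 n A hA hAn hsize hpack
  have hρ : 4 ≤ n / A := by
    rw [le_div_iff₀ hA]
    linarith
  have hℓ1 := one_lt_log_of_four_le hρ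
  have hlog := log_log_ge_of_four_le hρ
  have hexp : Real.exp (Real.log (n / A)) = n / A := Real.exp_log (by linarith)
  set ℓ := Real.log (n / A) with hℓ
  have hℓ1' : 1 < ℓ := lt_trans (by norm_num) hℓ1
  have hℓ0 : 0 < ℓ := by linarith
  have hexplam : Real.exp (Real.log ℓ) = ℓ := Real.exp_log hℓ0
  set lam := Real.log ℓ with hlam
  set t : ℝ := 2 * ℓ - 2 * (1 + E) * lam with ht
  obtain ⟨S, hSR, hSdisj, hScard⟩ := exists_packing 𝓡 A
  have hSc : c₃ * Real.exp ℓ ≤ S.card := by rwa [hexp, hScard]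
  have hsub : {ω : ι → ℝ × ℝ | ∀ R ∈ regionsOfSize 𝓡 A,
      logLR R (fun i => (ω i).1) (fun i => (ω i).2) ≤ t} ⊆
      {ω | ∀ R ∈ S, logLR R (fun i => (ω i).1) (fun i => (ω i).2) ≤ t} :=
    fun ω hω R hR => hω R (hSR hR)
  refine (measure_mono hsub).trans ?_
  rcases lt_or_ge t 0 with ht0 | ht0
  · -- a negative threshold lies below every `L_R`, and there is a region in the packing
    have hne : S.Nonempty := by
      have h1 : (0 : ℝ) < S.card := lt_of_lt_of_le (by positivity) hSc
      exact Finset.card_pos.1 (by exact_mod_cast h1)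
    obtain ⟨R, hR⟩ := hne
    have hempty : {ω : ι → ℝ × ℝ | ∀ R ∈ S,
        logLR R (fun i => (ω i).1) (fun i => (ω i).2) ≤ t} = ∅ := by
      ext ω
      simp only [Set.mem_ofPred_eq, Set.mem_empty_iff_false, iff_false]
      intro h
      have h1 := h R hR
      have h2 := logLR_nonneg (R := R) (by have := hsize R (hSR hR); omega)
        (fun i => (ω i).1) fun i => (ω i).2
      linarith
    rw [hempty]
    simp
  · set η : ℝ := 1 / (2 * ℓ) with hη
    have hη0 : 0 < η := by positivity
    have hη1 : η ≤ 1 := (div_le_one (by positivity)).2 (by linarith)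
    refine (nullPi_forall_logLR_le_le_exp hSdisj fun R hR =>
      le_nullPi_lt_logLR (hsize R (hSR hR)) ht0 hη0 hη1).trans (ENNReal.ofReal_le_ofReal ?_)
    refine le_trans (Real.exp_le_exp.2 (neg_le_neg ?_)) hE
    have hηt : η * t ≤ 1 := by
      rw [hη, one_div, inv_mul_le_iff₀ (by positivity)]
      nlinarith
    have hsqrt : η ≤ Real.sqrt η := by
      refine Real.le_sqrt_of_sq_le ?_
      nlinarith
    have hηlam : η = Real.exp (-lam) / 2 := by
      rw [Real.exp_neg, hexplam, hη]
      field_simp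
    calc c * Real.exp (E / 4) ≤ c * Real.exp (E * lam) := by
          gcongr
          nlinarith
      _ = c₃ * Real.exp ℓ * (gaussTailConst * η * Real.exp (-(1 + t) / 2)) := by
          rw [hηlam, hcdef]
          have h1 : Real.exp (-1 / 2) * Real.exp (E * lam) =
              Real.exp ℓ * Real.exp (-lam) * Real.exp (-(1 + t) / 2) := by
            rw [← Real.exp_add, ← Real.exp_add, ← Real.exp_add]
            congr 1
            rw [ht]
            ring
          linear_combination (c₃ * gaussTailConst / 2) * h1
      _ ≤ S.card * (gaussTailConst * Real.sqrt η * Real.exp (-((1 + η) * t) / 2)) := by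
          gcongr
          linarith

/-! ### Standardization -/

/-- The sample correlation does not depend on the location and scale of the two samples. -/
lemma pearsonCorr_standardize {ι : Type*} (R : Finset ι) (x y : ι → ℝ) (m₁ m₂ : ℝ) {s₁ s₂ : ℝ}
    (hs₁ : 0 < s₁) (hs₂ : 0 < s₂) :
    pearsonCorr R (fun i => (x i - m₁) / s₁) (fun i => (y i - m₂) / s₂) = pearsonCorr R x y := by
  rcases R.eq_empty_or_nonempty with rfl | hR
  · simp [pearsonCorr]
  have hc : (R.card : ℝ) ≠ 0 := by exact_mod_cast hR.card_pos.ne'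
  have hmean : ∀ (z : ι → ℝ) (m s : ℝ), ∀ i,
      (z i - m) / s - sampleMean R (fun i => (z i - m) / s) = (z i - sampleMean R z) / s := by
    intro z m s i
    unfold sampleMean
    rw [← Finset.sum_div, Finset.sum_sub_distrib, Finset.sum_const, nsmul_eq_mul]
    field_simp
    ring
  unfold pearsonCorr
  simp_rw [hmean, div_pow, div_mul_div_comm, ← Finset.sum_div]
  rw [div_mul_div_comm, ← mul_pow, Real.sqrt_div' _ (sq_nonneg _), Real.sqrt_sq (by positivity),
    div_div_div_cancel_right₀ (by positivity)]

lemma logLR_standardize {ι : Type*} (R : Finset ι) (x y : ι → ℝ) (m₁ m₂ : ℝ) {s₁ s₂ : ℝ}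
    (hs₁ : 0 < s₁) (hs₂ : 0 < s₂) :
    logLR R (fun i => (x i - m₁) / s₁) (fun i => (y i - m₂) / s₂) = logLR R x y := by
  unfold logLR
  rw [pearsonCorr_standardize R x y m₁ m₂ hs₁ hs₂]

lemma measurePreserving_standardize (m : ℝ) {s : ℝ} (hs : 0 < s) :
    MeasurePreserving (fun x => (x - m) / s) (gaussianReal m (Real.toNNReal (s ^ 2)))
      stdNormal := by
  refine ⟨by fun_prop, ?_⟩
  have h1 : (fun x : ℝ => (x - m) / s) = (fun x => x / s) ∘ fun x => x - m := rfl
  rw [h1, ← Measure.map_map (by fun_prop) (by fun_prop), gaussianReal_map_sub_const,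
    gaussianReal_map_div_const, sub_self, zero_div]
  congr 1
  ext
  simp only [NNReal.coe_div, NNReal.coe_one]
  rw [Real.coe_toNNReal _ (sq_nonneg s)]
  exact div_self (by positivity)

/-- The standardized pairs of a null model have the law `nullPi`. -/
lemma IsNullModel.hasLaw_standardize {ι Ω : Type*} [Fintype ι] [MeasurableSpace Ω] {P : Measure Ω}
    {X Y : ι → Ω → ℝ} {μ₁ μ₂ σ₁ σ₂ : ℝ} (h : IsNullModel P X Y μ₁ μ₂ σ₁ σ₂) (hσ₁ : 0 < σ₁)
    (hσ₂ : 0 < σ₂) :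
    HasLaw (fun ω i => ((X i ω - μ₁) / σ₁, (Y i ω - μ₂) / σ₂)) (nullPi ι) P := by
  have hmp := (measurePreserving_standardize μ₁ hσ₁).prod (measurePreserving_standardize μ₂ hσ₂)
  have hind := h.indep.comp (fun _ => Prod.map (fun x => (x - μ₁) / σ₁) fun y => (y - μ₂) / σ₂)
    (fun _ => by fun_prop)
  exact iIndepFun.hasLaw_pi (fun i => hmp.hasLaw.comp (h.law i)) hind

/-- A bound for a set of configurations transfers to every null model. -/
lemma IsNullModel.measure_le {ι Ω : Type*} [Fintype ι] [MeasurableSpace Ω] {P : Measure Ω}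
    {X Y : ι → Ω → ℝ} {μ₁ μ₂ σ₁ σ₂ : ℝ} (h : IsNullModel P X Y μ₁ μ₂ σ₁ σ₂) (hσ₁ : 0 < σ₁)
    (hσ₂ : 0 < σ₂) {E : (ι → ℝ × ℝ) → Prop} {p : ENNReal} (hE : nullPi ι {ω | E ω} ≤ p) :
    P {ω | E fun i => ((X i ω - μ₁) / σ₁, (Y i ω - μ₂) / σ₂)} ≤ p := by
  have hlaw := h.hasLaw_standardize hσ₁ hσ₂
  refine le_trans ?_ hE
  rw [← hlaw.map_eq]
  exact Measure.le_map_apply hlaw.aemeasurable {ω | E ω}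

/-! ### The two bounds for the maximum -/

lemma logLR_le_maxLogLR {ι : Type*} {𝓡 : Finset (Finset ι)} {A : ℝ} {R : Finset ι}
    (hR : R ∈ regionsOfSize 𝓡 A) (x y : ι → ℝ) : logLR R x y ≤ maxLogLR 𝓡 A x y :=
  le_ciSup (f := fun R : {R // R ∈ regionsOfSize 𝓡 A} => logLR R.1 x y)
    (Set.finite_range _).bddAbove ⟨R, hR⟩

lemma exists_lt_logLR_of_lt_maxLogLR {ι : Type*} {𝓡 : Finset (Finset ι)} {A t : ℝ} {x y : ι → ℝ}
    (ht : 0 ≤ t) (h : t < maxLogLR 𝓡 A x y) : ∃ R ∈ regionsOfSize 𝓡 A, t < logLR R x y := by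
  unfold maxLogLR at h
  rcases isEmpty_or_nonempty {R // R ∈ regionsOfSize 𝓡 A} with he | hne
  · rw [Real.iSup_of_isEmpty] at h
    linarith
  · obtain ⟨⟨R, hR⟩, hlt⟩ := exists_lt_of_lt_ciSup h
    exact ⟨R, hR, hlt⟩

theorem mainTheorem1
    {ι : ℕ → Type*} [∀ k, Fintype (ι k)] [∀ k, DecidableEq (ι k)]
    (n : ℕ → ℕ) (hn : ∀ k, n k = Fintype.card (ι k)) (hn_top : Tendsto n atTop atTop)
    {Ω : ℕ → Type*} [∀ k, MeasurableSpace (Ω k)]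
    (P : ∀ k, Measure (Ω k)) [∀ k, IsProbabilityMeasure (P k)]
    (X Y : ∀ k, ι k → Ω k → ℝ)
    (μ₁ μ₂ σ₁ σ₂ : ℕ → ℝ) (hσ₁ : ∀ k, 0 < σ₁ k) (hσ₂ : ∀ k, 0 < σ₂ k)
    (hnull : ∀ k, IsNullModel (P k) (X k) (Y k) (μ₁ k) (μ₂ k) (σ₁ k) (σ₂ k))
    (𝓡 : ∀ k, Finset (Finset (ι k)))
    (A : ℕ → ℝ) (hA_pos : ∀ k, 0 < A k) (hA_le : ∀ k, A k ≤ (n k : ℝ) / 4)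
    (hsize : ∀ k, ∀ R ∈ regionsOfSize (𝓡 k) (A k), 3 ≤ R.card)
    (hcomp : ∃ c₁ > (0 : ℝ), ∃ c₂ > (0 : ℝ), ∀ k,
      ((regionsOfSize (𝓡 k) (A k)).card : ℝ) ≤ c₁ * (n k : ℝ) * A k ^ c₂)
    (hentropy : ∃ c₄ > (0 : ℝ), ∃ c₅ > (0 : ℝ), ∃ c₆ > (0 : ℝ), ∀ k, ∀ ε : ℝ, 0 < ε → ε < 1 →
      (coveringNumber (𝓡 k) (A k) ε : ℝ) ≤
        c₄ * ((n k : ℝ) / A k) * Real.log ((n k : ℝ) / A k) ^ c₅ * (1 / ε) ^ c₆) :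
    (∃ Z : ∀ k, Ω k → ℝ,
      IsBigOInProb P Z (fun k => Real.log (Real.log ((n k : ℝ) / A k))) ∧
      ∀ k ω, maxLogLR (𝓡 k) (A k) (fun i => X k i ω) (fun i => Y k i ω) ≤
        2 * Real.log ((n k : ℝ) / A k) + Z k ω) ∧
    ((∃ c₃ > (0 : ℝ), ∀ k, c₃ * ((n k : ℝ) / A k) ≤ (packingNumber (𝓡 k) (A k) : ℝ)) →
      IsBigOInProb P
        (fun k ω => maxLogLR (𝓡 k) (A k) (fun i => X k i ω) (fun i => Y k i ω) -
          2 * Real.log ((n k : ℝ) / A k))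
        (fun k => Real.log (Real.log ((n k : ℝ) / A k)))) := by
  obtain ⟨c₁, hc₁, c₂, hc₂, hcomp⟩ := hcomp
  obtain ⟨c₄, hc₄, c₅, hc₅, c₆, hc₆, hentropy⟩ := hentropy
  have hρ : ∀ k, 4 ≤ (n k : ℝ) / A k := fun k => by
    rw [le_div_iff₀ (hA_pos k)]
    linarith [hA_le k]
  have hℓ : ∀ k, 0 < Real.log ((n k : ℝ) / A k) := fun k =>
    lt_trans (by norm_num) (one_lt_log_of_four_le (hρ k))
  have hlog : ∀ k, 0 < Real.log (Real.log ((n k : ℝ) / A k)) := fun k =>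
    lt_of_lt_of_le (by norm_num) (log_log_ge_of_four_le (hρ k))
  have hupper : ∀ δ : ℝ, 0 < δ → ∃ M > 0, ∀ᶠ k in atTop,
      P k {ω | 2 * Real.log ((n k : ℝ) / A k) + M * Real.log (Real.log ((n k : ℝ) / A k)) <
        maxLogLR (𝓡 k) (A k) (fun i => X k i ω) (fun i => Y k i ω)} ≤ ENNReal.ofReal δ := by
    intro δ hδ
    obtain ⟨M, hM, n₀, h⟩ := exists_nullPi_lt_logLR_le hc₁ hc₂ hc₄ hc₅ hc₆ hδ
    refine ⟨M, hM, ?_⟩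
    have hn₀ := (tendsto_natCast_atTop_atTop (R := ℝ)).comp hn_top |>.eventually_ge_atTop n₀
    filter_upwards [hn₀] with k hk
    refine (measure_mono ?_).trans ((hnull k).measure_le (hσ₁ k) (hσ₂ k)
      (h (𝓡 k) (n k) (A k) hk (hA_pos k) (hA_le k) (hsize k) (hcomp k) (hentropy k)))
    intro ω hω
    obtain ⟨R, hR, hlt⟩ := exists_lt_logLR_of_lt_maxLogLR
      (by have := hℓ k; have := hlog k; positivity) hω
    refine ⟨R, hR, ?_⟩
    rwa [logLR_standardize R (fun i => X k i ω) (fun i => Y k i ω) _ _ (hσ₁ k) (hσ₂ k)]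
  refine ⟨⟨fun k ω => max 0 (maxLogLR (𝓡 k) (A k) (fun i => X k i ω) (fun i => Y k i ω) -
    2 * Real.log ((n k : ℝ) / A k)), ?_, ?_⟩, ?_⟩
  · intro ε hε
    obtain ⟨M, hM, h⟩ := hupper ε hε
    refine ⟨M, h.mono fun k hk => le_trans (measure_mono fun ω hω => ?_) hk⟩
    have h1 : 0 < M * Real.log (Real.log ((n k : ℝ) / A k)) := mul_pos hM (hlog k)
    simp only [Set.mem_ofPred_eq] at hω ⊢
    rw [abs_of_nonneg (le_max_left _ _), lt_max_iff] at hω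
    rcases hω with hω | hω <;> linarith
  · intro k ω
    linarith [le_max_right 0 (maxLogLR (𝓡 k) (A k) (fun i => X k i ω) (fun i => Y k i ω) -
      2 * Real.log ((n k : ℝ) / A k))]
  · rintro ⟨c₃, hc₃, hpack⟩ ε hε
    obtain ⟨M₁, hM₁, h₁⟩ := hupper (ε / 2) (half_pos hε)
    obtain ⟨M₂, hM₂, h₂⟩ := exists_nullPi_forall_logLR_le_le hc₃ (half_pos hε)
    refine ⟨max M₁ M₂, h₁.mono fun k hk => ?_⟩
    have hlow := (hnull k).measure_le (hσ₁ k) (hσ₂ k)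
      (h₂ (𝓡 k) (n k) (A k) (hA_pos k) (hA_le k) (hsize k) (hpack k))
    refine le_trans (measure_mono fun ω hω => ?_) ((measure_union_le _ _).trans
      ((add_le_add hk hlow).trans (le_of_eq ?_)))
    · have h1 := mul_le_mul_of_nonneg_right (le_max_left M₁ M₂) (hlog k).le
      have h2 := mul_le_mul_of_nonneg_right (le_max_right M₁ M₂) (hlog k).le
      rw [Set.mem_ofPred_eq, lt_abs] at hω
      rcases hω with h | h
      · left
        simp only [Set.mem_ofPred_eq]
        linarith
      · right
        intro R hR
        rw [logLR_standardize R (fun i => X k i ω) (fun i => Y k i ω) _ _ (hσ₁ k) (hσ₂ k)]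
        have := logLR_le_maxLogLR hR (fun i => X k i ω) fun i => Y k i ω
        linarith
    · rw [← ENNReal.ofReal_add (half_pos hε).le (half_pos hε).le, add_halves]
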